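/- **Setting.** Let $Y=X^T\beta^*+\epsilon$ with $X\in\mathbb R^p$, $\mathbb E[XX^T]=\Sigma$, $\mathbb E[\epsilon\mid X]=0$ and $\mathrm{Var}[\epsilon\mid X]=\sigma^2$. There are $K$ missingness patterns $O_1,\dots,O_K\subseteq[p]$ with $\bigcup_k O_k=[p]$. The data consist of $n_k$ i.i.d. copies of $(X_{O_k},Y)$ for each $k\in[K]$ and of $N\ge 0$ i.i.d. copies of $X$, all independent; put $n_{\mathcal L}=\sum_k n_k$. Let $[p]=L_1\cup\dots\cup L_L$ be the partition into nonempty blocks (modalities) with the smallest number $L$ of blocks such that each $O_k$ is a union of blocks. For $g,h\in[L]$ let $h_g=\sum_k n_k\mathbb 1\{L_g\subseteq O_k\}$ and $n_{g,h}=\sum_k n_k\mathbb 1\{L_g\cup L_h\subseteq O_k\}$. Let $R,B>0$, $\chi\in(0,1]$, $C\ge1$, $0<\lambda_-<\lambda_+$, $C_X\geq\sqrt{8\lambda_+/3}$ and $\kappa_\epsilon\ge105^{1/4}$. Let $\mathcal P_{OSS}$ be the class of all such data-generating mechanisms for which - $\mathbb P(|X^T\theta|\le t(\theta^T\Sigma\theta)^{1/2})\le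 (Ct)^\chi$ for all $\theta\in\mathbb R^p\setminus\{0\}$ and $t>0$; - $\|X\|_{\psi_2}\le C_X$, where $\|X\|_{\psi_2}=\sup_{\|u\|_2=1}\inf\{s>0:\mathbb E\exp((u^TX)^2/s^2)\le2\}$; - all eigenvalues of $\Sigma$ lie in $[\lambda_-,\lambda_+]$; - $\|\beta^*\|_2\le B$, $\sigma\le R$ and $\mathbb E[\epsilon^8]^{1/4}\le\kappa_\epsilon\sigma^2$. Let $\mathcal P_{OSS}^{Gauss}$ be the subclass in which moreover $X\sim N(0,\Sigma)$, $\epsilon\sim N(0,\sigma^2)$, and $X,\epsilon$ are independent. Let $\hat\Theta_{OSS}$ be the set of functions $\hat\beta$ of the data with values in $\mathbb R^p$ such that $\|\hat\beta-\beta^*(P)\|_2$ is a measurable function of the data for every $P\in\mathcal P_{OSS}$. **Theorem.** There is a universal constant $c>0$ such that the following holds in the above setting. Let $p\ge2$ and $L\ge2$. Let $\rho\in(0,1)$ and $C_\rho>0$ be such that, for all distinct $g,h\in[L]$, $$\rho n_{\mathcal L}\le h_g\le C_\rho\,\rho n_{\mathcal L}\qquad\text{and}\qquad \rho^2n_{\mathcal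 L}\le n_{g,h}\le C_\rho\,\rho^2n_{\mathcal L}.$$ Suppose further that $$\rho n_{\mathcal L}\ge p\max\Big\{\frac12,\frac{R^2}{4B^2\lambda_-}\Big\}\qquad\text{and}\qquad \max\Big\{\frac{N+\rho^2n_{\mathcal L}}{B^2},\frac{\rho^2n_{\mathcal L}}{R^2}\Big\}\ge p\,\frac{\min\{1,\lambda_+^2\}}{2B^2(\lambda_+-\lambda_-)^2}.$$ Then $$\inf_{\hat\beta\in\hat\Theta_{OSS}}\ \sup_{P\in\mathcal P_{OSS}^{Gauss}}\mathbb E_P\big[\|\hat\beta-\beta^*(P)\|_2^2\big]\ \ge\ c\left(\frac{1}{C_\rho\lambda_-}\frac{R^2p}{\rho n_{\mathcal L}}+\frac{\min\{\lambda_+^{-2},1\}}{C_\rho}\min\Big\{\frac{B^2p}{N+\rho^2n_{\mathcal L}},\frac{R^2p}{\rho^2n_{\mathcal L}}\Big\}\right).$$ -/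

import Mathlib

open MeasureTheory ProbabilityTheory
open scoped ENNReal NNReal

namespace MissingRegression

noncomputable section

/-! ### The population model -/

/-- A data-generating mechanism of the well-specified linear model
`Y = Xᵀβ + ε` with `E[ε | X] = 0` and `Var[ε | X] = σ²`; `joint` is the law of `(X, ε)`. -/
structure Mechanism (p : ℕ) where
  joint : Measure (EuclideanSpace ℝ (Fin p) × ℝ)
  β : EuclideanSpace ℝ (Fin p)
  σ : ℝ
  isProb : IsProbabilityMeasure joint
  memLp_X : MemLp (fun z => z.1) 2 joint
  memLp_ε : MemLp (fun z => z.2) 2 joint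
  σ_nonneg : 0 ≤ σ
  condExp_ε : joint[fun z => z.2 | MeasurableSpace.comap Prod.fst inferInstance] =ᵐ[joint] 0
  condVar_ε : Var[fun z => z.2; joint | MeasurableSpace.comap Prod.fst inferInstance]
    =ᵐ[joint] fun _ => σ ^ 2

namespace Mechanism

variable {p : ℕ} (P : Mechanism p)

/-- The law `P_X` of the covariates. -/
def lawX : Measure (EuclideanSpace ℝ (Fin p)) := P.joint.map Prod.fst

/-- The law `P_XY` of `(X, Y)`, where `Y = Xᵀβ + ε`. -/
def lawXY : Measure (EuclideanSpace ℝ (Fin p) × ℝ) :=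
  P.joint.map fun z => (z.1, inner ℝ z.1 P.β + z.2)

/-- The law of `(X_O, Y)`. -/
def lawObs (O : Finset (Fin p)) : Measure ((O → ℝ) × ℝ) :=
  P.lawXY.map fun z => (fun i : O => z.1 (i : Fin p), z.2)

/-- The second moment matrix `Σ = E[X Xᵀ]`. -/
def secondMoment : Matrix (Fin p) (Fin p) ℝ :=
  Matrix.of fun i j => ∫ x, x i * x j ∂P.lawX

end Mechanism

/-- The sub-Gaussian norm `inf {K > 0 : E exp(Z² / K²) ≤ 2}` of a real random variable `Z` of
law `ν` (it is `∞` if there is no such `K`). -/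
def psi2Norm (ν : Measure ℝ) : ℝ≥0∞ :=
  ⨅ (K : ℝ≥0) (_ : 0 < K)
    (_ : ∫⁻ z, ENNReal.ofReal (Real.exp (z ^ 2 / (K : ℝ) ^ 2)) ∂ν ≤ 2), (K : ℝ≥0∞)

/-- The sub-Gaussian norm of a random vector: the supremum of the sub-Gaussian norms of its
one-dimensional marginals in the directions of the unit sphere. -/
def psi2NormVec {p : ℕ} (ν : Measure (EuclideanSpace ℝ (Fin p))) : ℝ≥0∞ :=
  ⨆ u ∈ Metric.sphere (0 : EuclideanSpace ℝ (Fin p)) 1, psi2Norm (ν.map fun x => inner ℝ x u)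

/-- The parameters `(χ, C, C_X, λ₋, λ₊, R, B, κ)` of the model classes. -/
structure ClassParams where
  χ : ℝ
  C : ℝ
  CX : ℝ
  lamMin : ℝ
  lamMax : ℝ
  R : ℝ
  B : ℝ
  κ : ℝ

/-- `‖θ‖_A = (θᵀ A θ)^{1/2}`. -/
def matNorm {p : ℕ} (A : Matrix (Fin p) (Fin p) ℝ) (θ : EuclideanSpace ℝ (Fin p)) : ℝ :=
  Real.sqrt (∑ i, ∑ j, θ i * A i j * θ j)

/-- The small-ball condition. -/
def SmallBall {p : ℕ} (P : Mechanism p) (C χ : ℝ) : Prop :=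
  ∀ θ : EuclideanSpace ℝ (Fin p), θ ≠ 0 → ∀ t : ℝ, 0 < t →
    P.lawX.real {x | |inner ℝ x θ| ≤ t * matNorm P.secondMoment θ} ≤ (C * t) ^ χ

/-- The class `𝒫_OSS`. The second moment matrix is symmetric, so its real spectrum is the set of
all its eigenvalues. -/
structure MemOSS {p : ℕ} (a : ClassParams) (P : Mechanism p) : Prop where
  smallBall : SmallBall P a.C a.χ
  subGaussian : psi2NormVec P.lawX ≤ ENNReal.ofReal a.CX
  eigen : spectrum ℝ P.secondMoment ⊆ Set.Icc a.lamMin a.lamMax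
  norm_β_le : ‖P.β‖ ≤ a.B
  σ_le : P.σ ≤ a.R
  memLp_noise : MemLp (fun z => z.2) 8 P.joint
  noise_moment : (∫ z, z.2 ^ 8 ∂P.joint) ^ (1 / 4 : ℝ) ≤ a.κ * P.σ ^ 2

/-- The Gaussian subclass `𝒫_OSS^Gauss`: moreover `X ∼ N(0, Σ)`, `ε ∼ N(0, σ²)`, and `X`, `ε` are
independent. -/
structure MemOSSGauss {p : ℕ} (a : ClassParams) (P : Mechanism p) : Prop extends MemOSS a P where
  gaussian_X : P.lawX = multivariateGaussian 0 P.secondMoment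
  gaussian_ε : P.joint.map Prod.snd = gaussianReal 0 (Real.toNNReal (P.σ ^ 2))
  indep : IndepFun Prod.fst Prod.snd P.joint

/-! ### Missingness patterns and the data -/

/-- `K` missingness patterns on `p` covariates: in pattern `k` exactly the covariates in `O k`
(and the response) are observed, in `n k` labelled samples. Each variable is in some pattern. -/
structure Pattern (p K : ℕ) where
  O : Fin K → Finset (Fin p)
  n : Fin K → ℕ
  covers : ∀ i, ∃ k, i ∈ O k

namespace Pattern

variable {p K : ℕ} (D : Pattern p K)

/-- The number of labelled samples `n_𝓛`. -/
def nLab : ℕ := ∑ k, D.n k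

/-- The number of labelled samples in which all the variables in `S` are observed. -/
def count (S : Finset (Fin p)) : ℕ := ∑ k, if S ⊆ D.O k then D.n k else 0

/-- The block `L_g = ξ⁻¹(g)` of a labelling `ξ` of the variables. -/
def block {L : ℕ} (ξ : Fin p → Fin L) (g : Fin L) : Finset (Fin p) :=
  Finset.univ.filter fun i => ξ i = g

/-- `ξ` describes a partition of the variables into `L` nonempty blocks such that each observed
set `O k` is a union of blocks. -/
structure IsBlockPartition {L : ℕ} (ξ : Fin p → Fin L) : Prop where
  surj : Function.Surjective ξ
  union : ∀ k, ∃ G : Finset (Fin L), D.O k = G.biUnion (block ξ)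

/-- `ξ` maps each variable to its modality: the modalities are the blocks of the partition of the
above kind with the smallest number of blocks. -/
structure IsModalityMap {L : ℕ} (ξ : Fin p → Fin L) : Prop extends D.IsBlockPartition ξ where
  minimal : ∀ (L' : ℕ) (ξ' : Fin p → Fin L'), D.IsBlockPartition ξ' → L ≤ L'

/-- The modality sample size `h_g`. -/
def h {L : ℕ} (ξ : Fin p → Fin L) (g : Fin L) : ℕ := D.count (block ξ g)

/-- The cross-modality sample size `n_{g,h}`. -/
def nCross {L : ℕ} (ξ : Fin p → Fin L) (g g' : Fin L) : ℕ := D.count (block ξ g ∪ block ξ g')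

/-- The balanced unstructured pattern with observation rate `ρ` and balancing constant `Cρ`. -/
structure IsBalanced {L : ℕ} (ξ : Fin p → Fin L) (ρ Cρ : ℝ) : Prop where
  h_lower : ∀ g, ρ * D.nLab ≤ D.h ξ g
  h_upper : ∀ g, (D.h ξ g : ℝ) ≤ Cρ * ρ * D.nLab
  cross_lower : ∀ g g', g ≠ g' → ρ ^ 2 * D.nLab ≤ D.nCross ξ g g'
  cross_upper : ∀ g g', g ≠ g' → (D.nCross ξ g g' : ℝ) ≤ Cρ * ρ ^ 2 * D.nLab

/-- The sample space `∏ₖ (ℝ^{|O_k|+1})^{n_k} × (ℝ^p)^N` of the labelled and unlabelled data. -/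
abbrev Sample (N : ℕ) : Type :=
  ((k : Fin K) → Fin (D.n k) → ((D.O k → ℝ) × ℝ)) × (Fin N → EuclideanSpace ℝ (Fin p))

/-- The law of the data: all samples are independent, the labelled ones in pattern `k` have the
law of `(X_{O_k}, Y)`, and the unlabelled ones have the law of `X`. -/
def dataLaw (N : ℕ) (P : Mechanism p) : Measure (D.Sample N) :=
  (Measure.pi fun k => Measure.pi fun _ : Fin (D.n k) => P.lawObs (D.O k)).prod
    (Measure.pi fun _ : Fin N => P.lawX)

/-- The set `Θ̂_OSS` of estimators. -/
def estimators (N : ℕ) (a : ClassParams) : Set (D.Sample N → EuclideanSpace ℝ (Fin p)) :=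
  {est | ∀ P : Mechanism p, MemOSS a P → Measurable fun x => ‖est x - P.β‖}

/-- The minimax risk `inf_{β̂ ∈ Θ̂_OSS} sup_{P ∈ 𝒫_OSS^Gauss} E_P ‖β̂ - β*(P)‖²`. -/
def minimaxRisk (N : ℕ) (a : ClassParams) : ℝ≥0∞ :=
  ⨅ est ∈ D.estimators N a, ⨆ (P : Mechanism p) (_ : MemOSSGauss a P),
    ∫⁻ x, ENNReal.ofReal (‖est x - P.β‖ ^ 2) ∂(D.dataLaw N P)

end Pattern

end

end MissingRegression

namespace MissingRegression

/-! ### Pairs of measures with bounded Kullback-Leibler divergence -/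

/-! The risk is bounded below by Assouad's method on two hypercubes of Gaussian mechanisms, one for
each term of the bound. In each, flipping one sign changes one coordinate of the coefficient vector
by a fixed amount, while the law of the whole data set moves by a Kullback-Leibler divergence of at
most 1 (`le_minimaxRisk`).

First cube (`isotropic_lower_bound`): the covariance is λ₋ times the identity and the coefficients
are ±τ. If coordinate `j` is not observed, reflecting it preserves the law of X, so the sign of the
coefficient at `j` leaves no trace in (X_O, Y). Only the `h_g` samples observing the modality of `j`
carry information, which gives R²p/(ρ n).

Second cube (`hub_lower_bound`): a hub coordinate `h` has unknown covariances w = (±τ) with the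
coordinates `J` outside its modality, and the coefficient vector is (B/2)(e_h − w/l). Then Xᵀβ is a
multiple of the residual of X_h after regression on the other covariates, so Y is independent of
those. Without X_h the signs are invisible; with X_h but without X_j, a reflection hides the sign at
`j` (`lawObs_hubMechanism_reflectAt`). Only samples observing both, and unlabelled samples, are
informative. An unlabelled sample costs a shift of the hub residual; a complete labelled one costs
in addition a shift of the noise. This yields the minimum in the second term.

Every divergence reduces to a Gaussian shift whose size depends on an independent variable
(`klBounded_shift`, `klBounded_shift_shift`). `KLBounded` keeps a dominating pair upstairs, so data
processing is composition of maps and independent samples add log-densities; no divergence between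
the observed laws themselves is computed. -/

/-- The probability measure `μ` on `W` is tilted by the density `exp L`. -/
structure IsLogDensity {W : Type} [MeasurableSpace W] (μ : Measure W) (L : W → ℝ) : Prop where
  isProb : IsProbabilityMeasure μ
  measurable : Measurable L
  integrable : Integrable L μ
  lintegral_exp : ∫⁻ w, ENNReal.ofReal (Real.exp (L w)) ∂μ = 1

/-- `P` and `Q` are images, under one measurable map, of a probability measure and of a tilted
version of it, whose Kullback-Leibler divergence is at most `r`. -/
def KLBounded {Ω : Type} [MeasurableSpace Ω] (P Q : Measure Ω) (r : ℝ) : Prop :=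
  ∃ (W : Type) (_ : MeasurableSpace W) (μ : Measure W) (T : W → Ω) (L : W → ℝ),
    IsLogDensity μ L ∧ Measurable T ∧ P = μ.map T ∧
      Q = (μ.withDensity fun w => ENNReal.ofReal (Real.exp (L w))).map T ∧ -∫ w, L w ∂μ ≤ r

namespace IsLogDensity

variable {W : Type} [MeasurableSpace W] {μ : Measure W} {L : W → ℝ}

lemma measurable_density (h : IsLogDensity μ L) :
    Measurable fun w => ENNReal.ofReal (Real.exp (L w)) := by
  have := h.measurable
  fun_prop

lemma isProbabilityMeasure_tilt (h : IsLogDensity μ L) :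
    IsProbabilityMeasure (μ.withDensity fun w => ENNReal.ofReal (Real.exp (L w))) :=
  ⟨by rw [withDensity_apply _ MeasurableSet.univ, setLIntegral_univ, h.lintegral_exp]⟩

lemma zero (μ : Measure W) [IsProbabilityMeasure μ] : IsLogDensity μ fun _ => 0 where
  isProb := inferInstance
  measurable := measurable_const
  integrable := integrable_zero _ _ _
  lintegral_exp := by simp

lemma withDensity_prod {V : Type} [MeasurableSpace V] {ν : Measure V} {M : V → ℝ}
    (h : IsLogDensity μ L) (h' : IsLogDensity ν M) :
    (μ.withDensity fun w => ENNReal.ofReal (Real.exp (L w))).prod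
        (ν.withDensity fun w => ENNReal.ofReal (Real.exp (M w))) =
      (μ.prod ν).withDensity fun z => ENNReal.ofReal (Real.exp (L z.1 + M z.2)) := by
  have := h.isProb
  have := h'.isProb
  have := h.isProbabilityMeasure_tilt
  have := h'.isProbabilityMeasure_tilt
  rw [prod_withDensity h.measurable_density h'.measurable_density]
  congr 1
  ext z
  rw [Real.exp_add, ENNReal.ofReal_mul (Real.exp_pos _).le]

lemma prod {V : Type} [MeasurableSpace V] {ν : Measure V} {M : V → ℝ}
    (h : IsLogDensity μ L) (h' : IsLogDensity ν M) :
    IsLogDensity (μ.prod ν) fun z => L z.1 + M z.2 := by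
  have := h.isProb
  have := h'.isProb
  refine ⟨inferInstance, ?_, (h.integrable.comp_fst ν).add (h'.integrable.comp_snd μ), ?_⟩
  · have := h.measurable
    have := h'.measurable
    fun_prop
  · have := h.isProbabilityMeasure_tilt
    have := h'.isProbabilityMeasure_tilt
    rw [← setLIntegral_univ, ← withDensity_apply _ MeasurableSet.univ, ← h.withDensity_prod h']
    exact measure_univ

section Pi

variable {ι : Type} [Fintype ι] {V : ι → Type} [∀ i, MeasurableSpace (V i)]
  {ν : ∀ i, Measure (V i)} {M : ∀ i, V i → ℝ}

lemma withDensity_pi (h : ∀ i, IsLogDensity (ν i) (M i)) :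
    (Measure.pi fun i => (ν i).withDensity fun w => ENNReal.ofReal (Real.exp (M i w))) =
      (Measure.pi ν).withDensity fun z => ENNReal.ofReal (Real.exp (∑ i, M i (z i))) := by
  have := fun i => (h i).isProb
  have := fun i => (h i).isProbabilityMeasure_tilt
  refine Measure.pi_eq fun s hs => ?_
  rw [withDensity_apply _ (MeasurableSet.univ_pi hs),
    ← lintegral_indicator (MeasurableSet.univ_pi hs)]
  -- Restricted to a box, the exponential of a sum splits into functions of single coordinates,
  -- which are independent under the product measure.
  have key : ∀ z : (∀ i, V i), (Set.univ.pi s).indicator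
      (fun z => ENNReal.ofReal (Real.exp (∑ i, M i (z i)))) z =
      ∏ i, (s i).indicator (fun w => ENNReal.ofReal (Real.exp (M i w))) (z i) := by
    intro z
    by_cases hz : z ∈ Set.univ.pi s
    · rw [Set.indicator_of_mem hz, Real.exp_sum, ENNReal.ofReal_prod_of_nonneg
        fun i _ => (Real.exp_pos _).le]
      exact Finset.prod_congr rfl fun i _ => by
        rw [Set.indicator_of_mem (hz i trivial)]
    · rw [Set.indicator_of_notMem hz]
      obtain ⟨i, hi⟩ : ∃ i, z i ∉ s i := by simpa [Set.mem_pi] using hz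
      exact (Finset.prod_eq_zero (Finset.mem_univ i) (Set.indicator_of_notMem hi _)).symm
  simp_rw [key]
  have hm : ∀ i, Measurable ((s i).indicator fun w => ENNReal.ofReal (Real.exp (M i w))) :=
    fun i => (h i).measurable_density.indicator (hs i)
  rw [lintegral_prod_eq_prod_lintegral_of_indepFun Finset.univ _
    (iIndepFun_pi (μ := ν) fun i => (hm i).aemeasurable)
    (fun i => (hm i).comp (measurable_pi_apply i))]
  refine Finset.prod_congr rfl fun i _ => ?_
  rw [withDensity_apply _ (hs i), ← lintegral_indicator (hs i)]
  exact ((measurePreserving_eval ν i).lintegral_comp (hm i))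

lemma pi (h : ∀ i, IsLogDensity (ν i) (M i)) :
    IsLogDensity (Measure.pi ν) fun z => ∑ i, M i (z i) := by
  have := fun i => (h i).isProb
  refine ⟨inferInstance, ?_, ?_, ?_⟩
  · have := fun i => (h i).measurable
    fun_prop
  · exact integrable_finsetSum _ fun i _ => integrable_comp_eval (h i).integrable
  · have := fun i => (h i).isProbabilityMeasure_tilt
    rw [← setLIntegral_univ, ← withDensity_apply _ MeasurableSet.univ, ← withDensity_pi h]
    exact measure_univ

end Pi

/-- The overlap of a probability measure and its tilted version. -/
lemma le_lintegral_min (h : IsLogDensity μ L) (hL : -∫ w, L w ∂μ ≤ 1) :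
    ENNReal.ofReal (Real.exp (-2)) ≤ ∫⁻ w, ENNReal.ofReal (min 1 (Real.exp (L w))) ∂μ := by
  have := h.isProb
  have hm := h.measurable
  have hexp : Integrable (fun w => Real.exp (L w)) μ := by
    refine ⟨by fun_prop, ?_⟩
    rw [hasFiniteIntegral_iff_ofReal (Filter.Eventually.of_forall fun w => (Real.exp_pos _).le),
      h.lintegral_exp]
    exact ENNReal.one_lt_top
  have hone : ∫ w, Real.exp (L w) ∂μ = 1 := by
    rw [integral_eq_lintegral_of_nonneg_ae
      (Filter.Eventually.of_forall fun w => (Real.exp_pos _).le) (by fun_prop), h.lintegral_exp]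
    simp
  have hmin : Integrable (fun w => min 1 (Real.exp (L w))) μ := by
    refine (integrable_const (1 : ℝ)).mono' (by fun_prop) (Filter.Eventually.of_forall fun w => ?_)
    rw [Real.norm_of_nonneg (le_min zero_le_one (Real.exp_pos _).le)]
    exact min_le_left _ _
  rw [← ofReal_integral_eq_lintegral_ofReal hmin
    (Filter.Eventually.of_forall fun w => le_min zero_le_one (Real.exp_pos _).le)]
  refine ENNReal.ofReal_le_ofReal ?_
  -- Both `0` and `L` dominate `L - exp L`, so the minimum is at least `exp (L - exp L)`; the
  -- tangent line of exp at -2 bounds this from below. The mean of `L` is at least -1 and that of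
  -- `exp L` is 1, so the bracket integrates to at least 1.
  have hpt : ∀ w, Real.exp (-2) * (3 + (L w - Real.exp (L w))) ≤ min 1 (Real.exp (L w)) := by
    intro w
    have e2 : 0 < Real.exp (-2) := Real.exp_pos _
    have hx : ∀ x : ℝ, Real.exp (-2) * (3 + x) ≤ Real.exp x := by
      intro x
      have h1 : Real.exp x = Real.exp (-2) * Real.exp (x + 2) := by
        rw [← Real.exp_add]; ring_nf
      rw [h1]
      refine mul_le_mul_of_nonneg_left ?_ e2.le
      linarith [Real.add_one_le_exp (x + 2)]
    refine le_min ?_ ?_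
    · have h1 := hx 0
      rw [Real.exp_zero] at h1
      refine le_trans (mul_le_mul_of_nonneg_left ?_ e2.le) h1
      linarith [Real.add_one_le_exp (L w)]
    · refine le_trans (mul_le_mul_of_nonneg_left ?_ e2.le) (hx (L w))
      linarith [Real.exp_pos (L w)]
  have hint : Integrable (fun w => Real.exp (-2) * (3 + (L w - Real.exp (L w)))) μ :=
    ((integrable_const _).add (h.integrable.sub hexp)).const_mul _
  refine le_trans ?_ (integral_mono hint hmin hpt)
  have hval : ∫ w, (3 + (L w - Real.exp (L w))) ∂μ = 3 + (∫ w, L w ∂μ - 1) := by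
    rw [← hone, ← integral_sub h.integrable hexp]
    simpa using integral_add (integrable_const (3 : ℝ)) (h.integrable.sub hexp)
  rw [integral_const_mul, hval]
  have e2 : 0 < Real.exp (-2) := Real.exp_pos _
  nlinarith

end IsLogDensity

namespace KLBounded

variable {Ω : Type} [MeasurableSpace Ω] {P Q : Measure Ω} {r : ℝ}

lemma refl (P : Measure Ω) [IsProbabilityMeasure P] : KLBounded P P 0 :=
  ⟨Ω, inferInstance, P, id, fun _ => 0, IsLogDensity.zero P, measurable_id, by simp, by simp,
    by simp⟩

lemma mono {r' : ℝ} (h : KLBounded P Q r) (hr : r ≤ r') : KLBounded P Q r' := by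
  obtain ⟨W, _, μ, T, L, h1, h2, h3, h4, h5⟩ := h
  exact ⟨W, _, μ, T, L, h1, h2, h3, h4, h5.trans hr⟩

lemma map {Ω' : Type} [MeasurableSpace Ω'] (h : KLBounded P Q r) {f : Ω → Ω'} (hf : Measurable f) :
    KLBounded (P.map f) (Q.map f) r := by
  obtain ⟨W, _, μ, T, L, h1, h2, rfl, rfl, h5⟩ := h
  exact ⟨W, _, μ, f ∘ T, L, h1, hf.comp h2, Measure.map_map hf h2, Measure.map_map hf h2, h5⟩

lemma prod {Ω' : Type} [MeasurableSpace Ω'] {P' Q' : Measure Ω'} {r' : ℝ} (h : KLBounded P Q r)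
    (h' : KLBounded P' Q' r') : KLBounded (P.prod P') (Q.prod Q') (r + r') := by
  obtain ⟨W, _, μ, T, L, h1, h2, rfl, rfl, h5⟩ := h
  obtain ⟨W', _, μ', T', L', h1', h2', rfl, rfl, h5'⟩ := h'
  have := h1.isProb
  have := h1'.isProb
  have := h1.isProbabilityMeasure_tilt
  have := h1'.isProbabilityMeasure_tilt
  refine ⟨W × W', inferInstance, μ.prod μ', Prod.map T T', _, h1.prod h1', h2.prodMap h2',
    Measure.map_prod_map _ _ h2 h2', ?_, ?_⟩
  · rw [Measure.map_prod_map _ _ h2 h2', h1.withDensity_prod h1']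
  · rw [integral_add (h1.integrable.comp_fst _) (h1'.integrable.comp_snd _),
      integral_fun_fst, integral_fun_snd]
    simp only [probReal_univ, one_smul]
    linarith

lemma pi {ι : Type} [Fintype ι] {V : ι → Type} [∀ i, MeasurableSpace (V i)]
    {P Q : ∀ i, Measure (V i)} {r : ι → ℝ} (h : ∀ i, KLBounded (P i) (Q i) (r i)) :
    KLBounded (Measure.pi P) (Measure.pi Q) (∑ i, r i) := by
  choose W mW μ T L h1 h2 h3 h4 h5 using h
  obtain rfl : P = _ := funext h3
  obtain rfl : Q = _ := funext h4
  have := fun i => (h1 i).isProb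
  have := fun i => (h1 i).isProbabilityMeasure_tilt
  have hp : ∀ i, IsProbabilityMeasure ((μ i).map (T i)) :=
    fun i => Measure.isProbabilityMeasure_map (h2 i).aemeasurable
  have hq : ∀ i, IsProbabilityMeasure
      (((μ i).withDensity fun w => ENNReal.ofReal (Real.exp (L i w))).map (T i)) :=
    fun i => Measure.isProbabilityMeasure_map (h2 i).aemeasurable
  refine ⟨∀ i, W i, inferInstance, Measure.pi μ, fun z i => T i (z i), _, IsLogDensity.pi h1,
    by fun_prop, ?_, ?_, ?_⟩
  · exact (Measure.pi_map_pi fun i => (h2 i).aemeasurable).symm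
  · rw [← IsLogDensity.withDensity_pi h1]
    exact (Measure.pi_map_pi fun i => (h2 i).aemeasurable).symm
  · rw [integral_finsetSum _ fun i _ => integrable_comp_eval (h1 i).integrable,
      ← Finset.sum_neg_distrib]
    refine Finset.sum_le_sum fun i _ => ?_
    rw [integral_comp_eval (h1 i).integrable.aestronglyMeasurable]
    exact h5 i

/-- Two hypotheses of small divergence cannot be separated by an estimator. -/
lemma two_point (h : KLBounded P Q 1) {t : Ω → ℝ} (ht : Measurable t) (x : ℝ) :
    ENNReal.ofReal (2 * x ^ 2 * Real.exp (-2)) ≤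
      ∫⁻ ω, ENNReal.ofReal ((t ω - x) ^ 2) ∂P + ∫⁻ ω, ENNReal.ofReal ((t ω + x) ^ 2) ∂Q := by
  obtain ⟨W, _, μ, T, L, h1, h2, rfl, rfl, h5⟩ := h
  have hL := h1.measurable
  rw [lintegral_map (by fun_prop) h2, lintegral_map (by fun_prop) h2,
    lintegral_withDensity_eq_lintegral_mul _ h1.measurable_density (by fun_prop),
    ← lintegral_add_left (by fun_prop), ENNReal.ofReal_mul (by positivity)]
  refine (mul_le_mul_right (h1.le_lintegral_min h5) _).trans ?_
  rw [← lintegral_const_mul _ (by fun_prop)]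
  refine lintegral_mono fun w => ?_
  simp only [Pi.mul_apply]
  rw [← ENNReal.ofReal_mul (Real.exp_pos _).le, ← ENNReal.ofReal_mul (by positivity),
    ← ENNReal.ofReal_add (by positivity) (by positivity)]
  refine ENNReal.ofReal_le_ofReal ?_
  have m1 : min 1 (Real.exp (L w)) ≤ 1 := min_le_left _ _
  have m2 : min 1 (Real.exp (L w)) ≤ Real.exp (L w) := min_le_right _ _
  have m0 : 0 ≤ min 1 (Real.exp (L w)) := le_min zero_le_one (Real.exp_pos _).le
  generalize min 1 (Real.exp (L w)) = m at *
  -- With common weight m, (t − x)² + (t + x)² = 2t² + 2x² ≥ 2x².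
  have e1 := mul_le_mul_of_nonneg_right m1 (sq_nonneg (t (T w) - x))
  have e2 := mul_le_mul_of_nonneg_right m2 (sq_nonneg (t (T w) + x))
  have e3 := mul_nonneg m0 (sq_nonneg (t (T w)))
  nlinarith

end KLBounded

/-! ### Gaussian shifts -/

lemma gaussianReal_map_add_eq_withDensity {s : ℝ≥0} (hs : s ≠ 0) (c : ℝ) :
    (gaussianReal 0 s).map (fun z => z + c) = (gaussianReal 0 s).withDensity
      fun z => ENNReal.ofReal (Real.exp ((z * c - c ^ 2 / 2) / s)) := by
  rw [gaussianReal_map_add_const, gaussianReal_of_var_ne_zero _ hs, gaussianReal_of_var_ne_zero _ hs,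
    ← withDensity_mul _ (measurable_gaussianPDF _ _) (by fun_prop)]
  congr 1
  ext z
  simp only [Pi.mul_apply, gaussianPDF]
  rw [← ENNReal.ofReal_mul (gaussianPDFReal_nonneg _ _ _)]
  congr 1
  simp only [gaussianPDFReal]
  rw [mul_assoc (Real.sqrt _)⁻¹, ← Real.exp_add]
  congr 2
  have : (s : ℝ) ≠ 0 := by exact_mod_cast hs
  field_simp
  ring

section Shift

variable {U : Type} [MeasurableSpace U] {ν : Measure U}

/-- For frozen first coordinate the shift is a constant, so Fubini reduces the claim to the
one-dimensional Gaussian density ratio. -/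
lemma map_shift_eq_withDensity [IsProbabilityMeasure ν] {s : ℝ≥0} (hs : s ≠ 0) {f : U → ℝ}
    (hf : Measurable f) :
    (ν.prod (gaussianReal 0 s)).map (fun z => (z.1, z.2 + f z.1)) =
      (ν.prod (gaussianReal 0 s)).withDensity
        fun z => ENNReal.ofReal (Real.exp ((z.2 * f z.1 - f z.1 ^ 2 / 2) / s)) := by
  refine Measure.ext_of_lintegral _ fun F hF => ?_
  rw [lintegral_map hF (by fun_prop), lintegral_prod _ (by fun_prop),
    lintegral_withDensity_eq_lintegral_mul _ (by fun_prop) hF, lintegral_prod _ (by fun_prop)]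
  refine lintegral_congr fun u => ?_
  have h1 : ∫⁻ z, F (u, z + f u) ∂gaussianReal 0 s =
      ∫⁻ z, F (u, z) ∂((gaussianReal 0 s).map fun z => z + f u) :=
    (lintegral_map (f := fun z => F (u, z)) (by fun_prop) (by fun_prop)).symm
  rw [h1, gaussianReal_map_add_eq_withDensity hs,
    lintegral_withDensity_eq_lintegral_mul _ (by fun_prop) (by fun_prop)]
  rfl

/-- The tilted measure is a push-forward of a probability measure, so its mass is 1 without
evaluating any exponential moment. -/
lemma isLogDensity_of_map {W : Type} [MeasurableSpace W] {μ : Measure W} [IsProbabilityMeasure μ]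
    {S : W → W} (hS : Measurable S) {L : W → ℝ} (hL : Measurable L) (hi : Integrable L μ)
    (h : μ.map S = μ.withDensity fun w => ENNReal.ofReal (Real.exp (L w))) :
    IsLogDensity μ L := by
  refine ⟨inferInstance, hL, hi, ?_⟩
  have := Measure.isProbabilityMeasure_map (μ := μ) hS.aemeasurable
  rw [← setLIntegral_univ, ← withDensity_apply _ MeasurableSet.univ, ← h]
  exact measure_univ

lemma integrable_shift [IsProbabilityMeasure ν] (s : ℝ≥0) {f : U → ℝ} (hf : MemLp f 2 ν) :
    Integrable (fun z : U × ℝ => (z.2 * f z.1 - f z.1 ^ 2 / 2) / s)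
      (ν.prod (gaussianReal 0 s)) := by
  have h1 : Integrable (fun z : U × ℝ => z.2 * f z.1) (ν.prod (gaussianReal 0 s)) := by
    simpa [mul_comm] using (hf.integrable one_le_two).mul_prod
      ((memLp_id_gaussianReal (μ := 0) (v := s) 1).integrable le_rfl)
  exact (h1.sub ((hf.integrable_sq.comp_fst _).div_const 2)).div_const _

lemma integral_shift [IsProbabilityMeasure ν] (s : ℝ≥0) {f : U → ℝ} (hf : MemLp f 2 ν) :
    ∫ z, (z.2 * f z.1 - f z.1 ^ 2 / 2) / s ∂(ν.prod (gaussianReal 0 s)) =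
      -((∫ u, f u ^ 2 ∂ν) / (2 * s)) := by
  have h1 : Integrable (fun z : U × ℝ => z.2 * f z.1) (ν.prod (gaussianReal 0 s)) := by
    simpa [mul_comm] using (hf.integrable one_le_two).mul_prod
      ((memLp_id_gaussianReal (μ := 0) (v := s) 1).integrable le_rfl)
  have h2 : ∫ z : U × ℝ, z.2 * f z.1 ∂(ν.prod (gaussianReal 0 s)) = 0 := by
    have := integral_prod_mul (μ := ν) (ν := gaussianReal 0 s) f (fun z => z)
    simp only [integral_id_gaussianReal, mul_zero] at this
    exact (integral_congr_ae
      (Filter.Eventually.of_forall fun z : U × ℝ => mul_comm z.2 (f z.1))).trans this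
  have h3 : ∫ z : U × ℝ, f z.1 ^ 2 ∂(ν.prod (gaussianReal 0 s)) = ∫ u, f u ^ 2 ∂ν := by
    simpa using integral_fun_fst (μ := ν) (ν := gaussianReal 0 s) fun u => f u ^ 2
  rw [integral_div, integral_sub h1 ((hf.integrable_sq.comp_fst _).div_const 2), h2, integral_div,
    h3]
  ring

/-- The divergence produced by a Gaussian shift. -/
lemma klBounded_shift [IsProbabilityMeasure ν] {s : ℝ≥0} (hs : s ≠ 0) {f : U → ℝ}
    (hf : Measurable f) (hf2 : MemLp f 2 ν) :
    KLBounded (ν.prod (gaussianReal 0 s))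
      ((ν.prod (gaussianReal 0 s)).map fun z => (z.1, z.2 + f z.1))
      ((∫ u, f u ^ 2 ∂ν) / (2 * s)) := by
  have h := map_shift_eq_withDensity (ν := ν) hs hf
  refine ⟨U × ℝ, inferInstance, _, id, _,
    isLogDensity_of_map (by fun_prop) (by fun_prop) (integrable_shift s hf2) h, measurable_id,
    by simp, by simp [h], ?_⟩
  rw [integral_shift s hf2, neg_neg]

/-- The divergence produced by two successive Gaussian shifts. -/
lemma klBounded_shift_shift [IsProbabilityMeasure ν] {s r : ℝ≥0} (hs : s ≠ 0) (hr : r ≠ 0)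
    {f g : U → ℝ} (hf : Measurable f) (hg : Measurable g) (hf2 : MemLp f 2 ν)
    (hg2 : MemLp g 2 ν) :
    KLBounded ((ν.prod (gaussianReal 0 s)).prod (gaussianReal 0 r))
      (((ν.prod (gaussianReal 0 s)).prod (gaussianReal 0 r)).map
        fun z => ((z.1.1, z.1.2 + f z.1.1), z.2 + g z.1.1))
      ((∫ u, f u ^ 2 ∂ν) / (2 * s) + (∫ u, g u ^ 2 ∂ν) / (2 * r)) := by
  have hfs := map_shift_eq_withDensity (ν := ν) hs hf
  have hg' : Measurable fun z : U × ℝ => g z.1 := by fun_prop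
  have hg2' : MemLp (fun z : U × ℝ => g z.1) 2 (ν.prod (gaussianReal 0 s)) := hg2.comp_fst _
  set L₁ : U × ℝ → ℝ := fun z => (z.2 * f z.1 - f z.1 ^ 2 / 2) / s with hL₁
  set L₂ : (U × ℝ) × ℝ → ℝ := fun z => (z.2 * g z.1.1 - g z.1.1 ^ 2 / 2) / r with hL₂
  have hm₁ : Measurable L₁ := by fun_prop
  have hm₂ : Measurable L₂ := by fun_prop
  have hi₁ : Integrable (fun z : (U × ℝ) × ℝ => L₁ z.1)
      ((ν.prod (gaussianReal 0 s)).prod (gaussianReal 0 r)) := (integrable_shift s hf2).comp_fst _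
  have hi₂ : Integrable L₂ ((ν.prod (gaussianReal 0 s)).prod (gaussianReal 0 r)) :=
    integrable_shift r hg2'
  have hS₁ : Measurable fun z : U × ℝ => (z.1, z.2 + f z.1) := by fun_prop
  have := Measure.isProbabilityMeasure_map (μ := ν.prod (gaussianReal 0 s)) hS₁.aemeasurable
  -- The second shift depends only on the variable that the first one leaves fixed, so the shifts
  -- can be performed one after the other and the densities multiply.
  have key : ((ν.prod (gaussianReal 0 s)).prod (gaussianReal 0 r)).map
      (fun z => ((z.1.1, z.1.2 + f z.1.1), z.2 + g z.1.1)) =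
      ((ν.prod (gaussianReal 0 s)).prod (gaussianReal 0 r)).withDensity
        fun z => ENNReal.ofReal (Real.exp (L₁ z.1 + L₂ z)) := by
    have h1 : (fun z : (U × ℝ) × ℝ => ((z.1.1, z.1.2 + f z.1.1), z.2 + g z.1.1)) =
        (fun z : (U × ℝ) × ℝ => (z.1, z.2 + g z.1.1)) ∘
          Prod.map (fun z : U × ℝ => (z.1, z.2 + f z.1)) id := rfl
    rw [h1, ← Measure.map_map (by fun_prop) (hS₁.prodMap measurable_id),
      ← Measure.map_prod_map _ _ hS₁ measurable_id, Measure.map_id,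
      map_shift_eq_withDensity hr hg']
    rw [hfs] at this ⊢
    rw [prod_withDensity_left (by fun_prop), ← withDensity_mul _ (by fun_prop) (by fun_prop)]
    congr 1
    ext z
    rw [Real.exp_add, ENNReal.ofReal_mul (Real.exp_pos _).le]
    rfl
  refine ⟨_, inferInstance, _, id, _,
    isLogDensity_of_map (by fun_prop) (by fun_prop) (hi₁.add hi₂) key, measurable_id,
    by simp, by simp [key], ?_⟩
  simp only [Pi.add_apply]
  rw [integral_add hi₁ hi₂, integral_fun_fst, integral_shift s hf2, integral_shift r hg2']
  have h3 : ∫ z : U × ℝ, g z.1 ^ 2 ∂(ν.prod (gaussianReal 0 s)) = ∫ u, g u ^ 2 ∂ν := by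
    simpa using integral_fun_fst (μ := ν) (ν := gaussianReal 0 s) fun u => g u ^ 2
  rw [h3]
  simp only [probReal_univ, one_smul]
  linarith

end Shift

/-! ### One-dimensional Gaussian estimates -/

/-- The density is at most (2πv)^(-1/2), and 2/√(2π) ≤ 1. -/
lemma gaussianReal_abs_le {v : ℝ≥0} (hv : v ≠ 0) {t : ℝ} (ht : 0 < t) :
    (gaussianReal 0 v).real {x | |x| ≤ t * Real.sqrt v} ≤ t := by
  have hv' : 0 < (v : ℝ) := by positivity
  have hset : {x : ℝ | |x| ≤ t * Real.sqrt v} = Set.Icc (-(t * Real.sqrt v)) (t * Real.sqrt v) := by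
    ext x; simp [abs_le]
  rw [hset, measureReal_def, gaussianReal_apply_eq_integral 0 hv, ENNReal.toReal_ofReal
    (integral_nonneg fun x => gaussianPDFReal_nonneg _ _ _)]
  have hb : ∀ x, gaussianPDFReal 0 v x ≤ (Real.sqrt (2 * Real.pi * v))⁻¹ := by
    intro x
    refine mul_le_of_le_one_right (by positivity) (Real.exp_le_one_iff.2 ?_)
    exact div_nonpos_of_nonpos_of_nonneg (by nlinarith [sq_nonneg (x - 0)]) (by positivity)
  have h1 : ∫ x in Set.Icc (-(t * Real.sqrt v)) (t * Real.sqrt v), gaussianPDFReal 0 v x ≤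
      ∫ x in Set.Icc (-(t * Real.sqrt v)) (t * Real.sqrt v), (Real.sqrt (2 * Real.pi * v))⁻¹ :=
    integral_mono (integrable_gaussianPDFReal 0 v).integrableOn (integrable_const _) hb
  refine h1.trans ?_
  rw [setIntegral_const, Real.volume_real_Icc_of_le (by linarith [mul_pos ht (Real.sqrt_pos.2 hv')]),
    smul_eq_mul, ← div_eq_mul_inv, div_le_iff₀ (by positivity)]
  have h2 : 2 * Real.sqrt v ≤ Real.sqrt (2 * Real.pi * v) := by
    refine Real.le_sqrt_of_sq_le ?_
    rw [mul_pow, Real.sq_sqrt hv'.le]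
    nlinarith [Real.pi_gt_three]
  nlinarith

/-- The integral equals (1 − 2v/K²)^(-1/2), which is at most 2 exactly when K² ≥ 8v/3; hence the
constant in the assumption on `CX`. -/
lemma lintegral_exp_sq_gaussianReal_le {v : ℝ≥0} (hv : v ≠ 0) {K : ℝ} (hK : 0 < K)
    (h : 8 * v / 3 ≤ K ^ 2) :
    ∫⁻ z, ENNReal.ofReal (Real.exp (z ^ 2 / K ^ 2)) ∂(gaussianReal 0 v) ≤ 2 := by
  have hv' : 0 < (v : ℝ) := by positivity
  have hK2 : 0 < K ^ 2 := by positivity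
  set b : ℝ := 1 / (2 * v) - 1 / K ^ 2 with hb
  have hbv : 1 / (8 * v) ≤ b := by
    have : 1 / K ^ 2 ≤ 1 / (8 * v / 3) := one_div_le_one_div_of_le (by positivity) h
    have e : (1 : ℝ) / (8 * v) = 1 / (2 * v) - 1 / (8 * v / 3) := by field_simp; ring
    rw [e, hb]; linarith
  have hb0 : 0 < b := lt_of_lt_of_le (by positivity) hbv
  rw [gaussianReal_of_var_ne_zero _ hv,
    lintegral_withDensity_eq_lintegral_mul _ (measurable_gaussianPDF _ _) (by fun_prop)]
  have e1 : ∀ z : ℝ, (gaussianPDF 0 v * fun z => ENNReal.ofReal (Real.exp (z ^ 2 / K ^ 2))) z =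
      ENNReal.ofReal ((Real.sqrt (2 * Real.pi * v))⁻¹ * Real.exp (-b * z ^ 2)) := by
    intro z
    simp only [Pi.mul_apply, gaussianPDF]
    rw [← ENNReal.ofReal_mul (gaussianPDFReal_nonneg _ _ _)]
    congr 1
    simp only [gaussianPDFReal]
    rw [mul_assoc, ← Real.exp_add]
    congr 2
    rw [hb]
    field_simp
    ring
  rw [lintegral_congr e1, ← ofReal_integral_eq_lintegral_ofReal
    ((integrable_exp_neg_mul_sq hb0).const_mul _)
    (Filter.Eventually.of_forall fun z => by positivity), integral_const_mul, integral_gaussian,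
    ← ENNReal.ofReal_ofNat]
  refine ENNReal.ofReal_le_ofReal ?_
  have e2 : (2 : ℝ) = Real.sqrt 4 := by
    rw [show (4 : ℝ) = 2 ^ 2 by norm_num, Real.sqrt_sq (by norm_num)]
  rw [inv_mul_le_iff₀ (by positivity)]
  nth_rewrite 2 [e2]
  rw [← Real.sqrt_mul (by positivity)]
  refine Real.sqrt_le_sqrt ?_
  rw [div_le_iff₀ hb0]
  have : 1 ≤ 8 * v * b := by
    have := mul_le_mul_of_nonneg_left hbv (show 0 ≤ 8 * (v : ℝ) by positivity)
    rwa [mul_one_div_cancel (by positivity)] at this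
  nlinarith [Real.pi_pos]

lemma psi2Norm_gaussianReal_le {v : ℝ≥0} (hv : v ≠ 0) {K : ℝ} (hK : 0 < K)
    (h : 8 * v / 3 ≤ K ^ 2) : psi2Norm (gaussianReal 0 v) ≤ ENNReal.ofReal K := by
  refine iInf_le_of_le K.toNNReal (iInf_le_of_le (by simpa using hK) (iInf_le_of_le ?_ le_rfl))
  rw [Real.coe_toNNReal _ hK.le]
  exact lintegral_exp_sq_gaussianReal_le hv hK h

/-- The source of the constant 105^(1/4) required of `κ`; after scaling to unit variance, the moment
is a value of Γ at 9/2. -/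
lemma integral_pow_eight_gaussianReal (v : ℝ≥0) :
    ∫ z, z ^ 8 ∂(gaussianReal 0 v) = 105 * (v : ℝ) ^ 4 := by
  have h1 : ∫ z, z ^ 8 ∂(gaussianReal 0 1) = 105 := by
    rw [integral_gaussianReal_eq_integral_smul one_ne_zero]
    have e1 : ∀ z : ℝ, gaussianPDFReal 0 1 z • z ^ 8 = (Real.sqrt (2 * Real.pi))⁻¹ *
        ((fun y : ℝ => y ^ (8 : ℝ) * Real.exp (-(1 / 2) * y ^ (2 : ℝ))) |z|) := by
      intro z
      simp only [gaussianPDFReal, smul_eq_mul]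
      have a8 : |z| ^ (8 : ℝ) = z ^ 8 := by
        rw [show (8 : ℝ) = ((8 : ℕ) : ℝ) by norm_num, Real.rpow_natCast,
          Even.pow_abs (by decide)]
      have a2 : |z| ^ (2 : ℝ) = z ^ 2 := by
        rw [show (2 : ℝ) = ((2 : ℕ) : ℝ) by norm_num, Real.rpow_natCast, sq_abs]
      rw [a8, a2]
      simp only [NNReal.coe_one, mul_one, sub_zero]
      rw [show -z ^ 2 / 2 = -(1 / 2) * z ^ 2 by ring]
      ring
    rw [integral_congr_ae (Filter.Eventually.of_forall e1), integral_const_mul,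
      integral_comp_abs (f := fun y : ℝ => y ^ (8 : ℝ) * Real.exp (-(1 / 2) * y ^ (2 : ℝ))),
      integral_rpow_mul_exp_neg_mul_rpow (by norm_num) (by norm_num) (by norm_num)]
    have hG : Real.Gamma ((8 + 1) / 2) = 105 / 16 * Real.sqrt Real.pi := by
      have := Real.Gamma_nat_add_one_add_half 3
      norm_num [Nat.doubleFactorial] at this
      rw [show ((8 : ℝ) + 1) / 2 = 3 + 1 + 1 / 2 by norm_num]
      rw [show (3 : ℝ) + 1 + 1 / 2 = 9 / 2 by norm_num]
      rw [this]
      ring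
    have hp : ((1 : ℝ) / 2) ^ (-(8 + 1) / 2 : ℝ) = 16 * Real.sqrt 2 := by
      rw [one_div, Real.inv_rpow (by norm_num), ← Real.rpow_neg (by norm_num),
        show (-(-(8 + 1) / 2) : ℝ) = (4 : ℕ) + 1 / 2 by norm_num, Real.rpow_add (by norm_num),
        Real.rpow_natCast, ← Real.sqrt_eq_rpow]
      norm_num
    rw [hG, hp, Real.sqrt_mul (by norm_num)]
    have := Real.sqrt_pos.2 Real.pi_pos
    field_simp
  have h2 : gaussianReal 0 v = (gaussianReal 0 1).map (fun x => Real.sqrt v * x) := by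
    rw [gaussianReal_map_const_mul]
    congr 1
    · simp
    · ext; simp
  rw [h2, integral_map (by fun_prop) (by fun_prop)]
  simp_rw [mul_pow]
  rw [integral_const_mul, h1, show Real.sqrt v ^ 8 = (Real.sqrt v ^ 2) ^ 4 by ring,
    Real.sq_sqrt v.coe_nonneg]
  ring

open Matrix

/-! ### Gaussian mechanisms -/

section GaussianLaw

variable {p : ℕ} {S : Matrix (Fin p) (Fin p) ℝ}

lemma sum_sum_eq_dotProduct_mulVec (A : Matrix (Fin p) (Fin p) ℝ) (θ : EuclideanSpace ℝ (Fin p)) :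
    ∑ i, ∑ j, θ i * A i j * θ j = θ.ofLp ⬝ᵥ A *ᵥ θ.ofLp := by
  simp only [dotProduct, mulVec, Finset.mul_sum, mul_assoc]

lemma map_inner_multivariateGaussian (hS : S.PosSemidef) (θ : EuclideanSpace ℝ (Fin p)) :
    (multivariateGaussian 0 S).map (fun x => inner ℝ x θ) =
      gaussianReal 0 (Real.toNNReal (θ.ofLp ⬝ᵥ S *ᵥ θ.ofLp)) := by
  have h1 : (fun x : EuclideanSpace ℝ (Fin p) => inner ℝ x θ) = innerSL ℝ θ := by
    ext x; simp [real_inner_comm]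
  rw [h1, IsGaussian.map_eq_gaussianReal]
  congr 1
  · rw [IsGaussian.integral_dual]
    simp
  · rw [← covariance_self (by fun_prop)]
    have h2 : ⇑(innerSL ℝ θ) = fun x => inner ℝ θ x := by ext x; simp
    rw [h2, ← covarianceBilin_apply_eq_cov IsGaussian.memLp_two_id,
      covarianceBilin_multivariateGaussian hS]

lemma integral_inner_sq_multivariateGaussian (hS : S.PosSemidef) (θ : EuclideanSpace ℝ (Fin p)) :
    ∫ x, inner ℝ x θ ^ 2 ∂(multivariateGaussian 0 S) = θ.ofLp ⬝ᵥ S *ᵥ θ.ofLp := by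
  have h0 : 0 ≤ θ.ofLp ⬝ᵥ S *ᵥ θ.ofLp := by simpa using hS.dotProduct_mulVec_nonneg θ.ofLp
  have h1 := integral_map (μ := multivariateGaussian 0 S)
    (φ := fun x : EuclideanSpace ℝ (Fin p) => inner ℝ x θ) (by fun_prop)
    (f := fun y : ℝ => y ^ 2) (by fun_prop)
  rw [← h1, map_inner_multivariateGaussian hS]
  have h2 := variance_fun_id_gaussianReal (μ := 0)
    (v := Real.toNNReal (θ.ofLp ⬝ᵥ S *ᵥ θ.ofLp))
  rw [variance_of_integral_eq_zero (by fun_prop) (by simp)] at h2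
  rw [h2, Real.coe_toNNReal _ h0]

lemma memLp_inner_multivariateGaussian (θ : EuclideanSpace ℝ (Fin p)) :
    MemLp (fun x => inner ℝ x θ) 2 (multivariateGaussian 0 S) := by
  have h1 : (fun x : EuclideanSpace ℝ (Fin p) => inner ℝ x θ) = innerSL ℝ θ := by
    ext x; simp [real_inner_comm]
  rw [h1]
  exact IsGaussian.memLp_dual _ _ _ (by simp)

/-- A finite measure with the characteristic function of a centred Gaussian is this Gaussian. -/
lemma eq_multivariateGaussian (hS : S.PosSemidef) (μ : Measure (EuclideanSpace ℝ (Fin p)))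
    [IsFiniteMeasure μ]
    (h : ∀ t, charFun μ t = Complex.exp (-((t.ofLp ⬝ᵥ S *ᵥ t.ofLp : ℝ) : ℂ) / 2)) :
    μ = multivariateGaussian 0 S := by
  refine Measure.ext_of_charFun (funext fun t => ?_)
  rw [h, charFun_multivariateGaussian hS]
  simp [neg_div]

end GaussianLaw

section Construction

variable {p : ℕ}

lemma indep_comap_snd_fst (μ : Measure (EuclideanSpace ℝ (Fin p))) (ν : Measure ℝ)
    [IsProbabilityMeasure μ] [IsProbabilityMeasure ν] :
    Indep (MeasurableSpace.comap Prod.snd inferInstance)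
      (MeasurableSpace.comap Prod.fst inferInstance) (μ.prod ν) :=
  (indepFun_prod (μ := μ) (ν := ν) (X := id) (Y := id) measurable_id measurable_id).symm

lemma stronglyMeasurable_comap_snd {f : ℝ → ℝ} (hf : Measurable f) :
    StronglyMeasurable[MeasurableSpace.comap (Prod.snd : EuclideanSpace ℝ (Fin p) × ℝ → ℝ)
      inferInstance] fun z : EuclideanSpace ℝ (Fin p) × ℝ => f z.2 :=
  (hf.comp (comap_measurable Prod.snd)).stronglyMeasurable

lemma condExp_snd (μ : Measure (EuclideanSpace ℝ (Fin p))) (ν : Measure ℝ)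
    [IsProbabilityMeasure μ] [IsProbabilityMeasure ν] {f : ℝ → ℝ} (hf : Measurable f) :
    (μ.prod ν)[fun z => f z.2 | MeasurableSpace.comap Prod.fst inferInstance]
      =ᵐ[μ.prod ν] fun _ => ∫ e, f e ∂ν := by
  have h := condExp_indep_eq measurable_snd.comap_le measurable_fst.comap_le
    (stronglyMeasurable_comap_snd (p := p) hf) (indep_comap_snd_fst μ ν)
  rw [integral_fun_snd] at h
  simpa using h

/-- The mechanism with `X ∼ N(0, S)` and an independent noise `ε ∼ N(0, σ²)`. -/
noncomputable def gaussianMechanism (S : Matrix (Fin p) (Fin p) ℝ)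
    (β : EuclideanSpace ℝ (Fin p)) (σ : ℝ) (hσ : 0 ≤ σ) : Mechanism p where
  joint := (multivariateGaussian 0 S).prod (gaussianReal 0 (Real.toNNReal (σ ^ 2)))
  β := β
  σ := σ
  isProb := inferInstance
  memLp_X := (IsGaussian.memLp_two_id (μ := multivariateGaussian 0 S)).comp_fst _
  memLp_ε := (IsGaussian.memLp_two_id (μ := gaussianReal 0 (Real.toNNReal (σ ^ 2)))).comp_snd _
  σ_nonneg := hσ
  condExp_ε := by
    refine (condExp_snd _ _ measurable_id).trans ?_
    simp only [id_eq, integral_id_gaussianReal]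
    rfl
  condVar_ε := by
    have hm := (IsGaussian.memLp_two_id
      (μ := gaussianReal 0 (Real.toNNReal (σ ^ 2)))).comp_snd (multivariateGaussian 0 S)
    refine (condVar_ae_eq_condExp_sq_sub_sq_condExp measurable_fst.comap_le hm).trans ?_
    have h1 := condExp_snd (multivariateGaussian 0 S)
      (gaussianReal 0 (Real.toNNReal (σ ^ 2))) measurable_id
    have h2 := condExp_snd (multivariateGaussian 0 S)
      (gaussianReal 0 (Real.toNNReal (σ ^ 2))) (f := fun e => e ^ 2) (by fun_prop)
    have h3 := variance_fun_id_gaussianReal (μ := 0) (v := Real.toNNReal (σ ^ 2))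
    rw [variance_of_integral_eq_zero (by fun_prop) (by simp),
      Real.coe_toNNReal _ (sq_nonneg σ)] at h3
    rw [h3] at h2
    simp only [id_eq, integral_id_gaussianReal] at h1
    filter_upwards [h1, h2] with z h1 h2
    refine (congrArg₂ (fun y x : ℝ => y - x ^ 2) h2 h1).trans ?_
    ring

variable {S : Matrix (Fin p) (Fin p) ℝ} {β : EuclideanSpace ℝ (Fin p)} {σ : ℝ} {hσ : 0 ≤ σ}

@[simp] lemma gaussianMechanism_β : (gaussianMechanism S β σ hσ).β = β := rfl

@[simp] lemma gaussianMechanism_σ : (gaussianMechanism S β σ hσ).σ = σ := rfl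

lemma gaussianMechanism_joint : (gaussianMechanism S β σ hσ).joint =
    (multivariateGaussian 0 S).prod (gaussianReal 0 (Real.toNNReal (σ ^ 2))) := rfl

@[simp] lemma gaussianMechanism_lawX :
    (gaussianMechanism S β σ hσ).lawX = multivariateGaussian 0 S := by
  simp [Mechanism.lawX, gaussianMechanism_joint, Measure.map_fst_prod]

lemma gaussianMechanism_secondMoment (hS : S.PosSemidef) :
    (gaussianMechanism S β σ hσ).secondMoment = S := by
  ext i j
  simp only [Mechanism.secondMoment, gaussianMechanism_lawX, Matrix.of_apply]
  rw [← covariance_eval_multivariateGaussian (μ := 0) hS i j, covariance]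
  have h : ∀ i : Fin p, ∫ x, x i ∂(multivariateGaussian 0 S) = 0 := by
    intro i
    have h1 := IsGaussian.integral_dual (μ := multivariateGaussian 0 S)
      (EuclideanSpace.proj i : EuclideanSpace ℝ (Fin p) →L[ℝ] ℝ)
    simpa using h1
  simp [h]

lemma spectrum_subset_Icc {l u : ℝ}
    (hl : ∀ x : Fin p → ℝ, l * (x ⬝ᵥ x) ≤ x ⬝ᵥ S *ᵥ x)
    (hu : ∀ x : Fin p → ℝ, x ⬝ᵥ S *ᵥ x ≤ u * (x ⬝ᵥ x)) :
    spectrum ℝ S ⊆ Set.Icc l u := by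
  intro μ hμ
  rw [← Matrix.spectrum_toLin', ← Module.End.hasEigenvalue_iff_mem_spectrum] at hμ
  obtain ⟨x, hx⟩ := hμ.exists_hasEigenvector
  have h1 : S *ᵥ x = μ • x := by simpa using hx.apply_eq_smul
  have h2 : 0 < x ⬝ᵥ x := by
    have := dotProduct_self_star_pos_iff.2 hx.2
    simpa using this
  have h3 := hl x
  have h4 := hu x
  rw [h1, dotProduct_smul, smul_eq_mul] at h3 h4
  exact ⟨le_of_mul_le_mul_right h3 h2, le_of_mul_le_mul_right h4 h2⟩

/-- Membership of a Gaussian mechanism in the Gaussian class. -/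
lemma memOSSGauss_gaussianMechanism {a : ClassParams} (hχ : 0 < a.χ) (hχ1 : a.χ ≤ 1)
    (hC : 1 ≤ a.C) (hlam : 0 < a.lamMin) (hlam' : a.lamMin < a.lamMax)
    (hCX : Real.sqrt (8 * a.lamMax / 3) ≤ a.CX) (hκ : (105 : ℝ) ^ (1 / 4 : ℝ) ≤ a.κ)
    (hS : S.PosSemidef)
    (hl : ∀ x : Fin p → ℝ, a.lamMin * (x ⬝ᵥ x) ≤ x ⬝ᵥ S *ᵥ x)
    (hu : ∀ x : Fin p → ℝ, x ⬝ᵥ S *ᵥ x ≤ a.lamMax * (x ⬝ᵥ x))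
    (hβ : ‖β‖ ≤ a.B) (hσR : σ ≤ a.R) : MemOSSGauss a (gaussianMechanism S β σ hσ) := by
  have hnorm : ∀ θ : EuclideanSpace ℝ (Fin p), θ.ofLp ⬝ᵥ θ.ofLp = ‖θ‖ ^ 2 := by
    intro θ
    rw [EuclideanSpace.real_norm_sq_eq]
    exact Finset.sum_congr rfl fun i _ => (sq _).symm
  have hpos : ∀ θ : EuclideanSpace ℝ (Fin p), θ ≠ 0 → 0 < θ.ofLp ⬝ᵥ S *ᵥ θ.ofLp := by
    intro θ hθ
    refine lt_of_lt_of_le ?_ (hl θ.ofLp)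
    rw [hnorm]
    have := norm_pos_iff.2 hθ
    positivity
  have hlamMax : 0 < a.lamMax := hlam.trans hlam'
  have hCX0 : 0 < a.CX := lt_of_lt_of_le (Real.sqrt_pos.2 (by positivity)) hCX
  refine ⟨⟨?_, ?_, ?_, hβ, hσR, ?_, ?_⟩, ?_, ?_, ?_⟩
  · intro θ hθ t ht
    rw [gaussianMechanism_secondMoment hS, gaussianMechanism_lawX, matNorm,
      sum_sum_eq_dotProduct_mulVec]
    have hv := hpos θ hθ
    have hv' : Real.toNNReal (θ.ofLp ⬝ᵥ S *ᵥ θ.ofLp) ≠ 0 := by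
      simpa using hv
    have h1 := gaussianReal_abs_le hv' ht
    rw [← map_inner_multivariateGaussian hS, map_measureReal_apply (by fun_prop)
      (measurableSet_le (by fun_prop) (by fun_prop)), Real.coe_toNNReal _ hv.le] at h1
    have hCt : 0 < a.C * t := by positivity
    have htC : t ≤ a.C * t := by nlinarith
    -- For Ct ≥ 1 the bound exceeds every probability; otherwise t ≤ Ct ≤ (Ct)^χ because χ ≤ 1.
    rcases le_total 1 (a.C * t) with h | h
    · exact measureReal_le_one.trans (Real.one_le_rpow h hχ.le)
    · refine (h1.trans htC).trans ?_
      simpa using Real.rpow_le_rpow_of_exponent_ge hCt h hχ1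
  · rw [gaussianMechanism_lawX]
    refine iSup₂_le fun u hu1 => ?_
    have hu1 : ‖u‖ = 1 := by simpa using hu1
    have hu0 : u ≠ 0 := by rintro rfl; simp at hu1
    rw [map_inner_multivariateGaussian hS]
    have hv := hpos u hu0
    refine psi2Norm_gaussianReal_le (by simpa using hv) hCX0 ?_
    rw [Real.coe_toNNReal _ hv.le]
    have h1 := hu u.ofLp
    rw [hnorm, hu1] at h1
    have h2 : 8 * a.lamMax / 3 ≤ a.CX ^ 2 := (Real.sqrt_le_left hCX0.le).1 hCX
    linarith
  · rw [gaussianMechanism_secondMoment hS]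
    exact spectrum_subset_Icc hl hu
  · exact (memLp_id_gaussianReal' (μ := 0) (v := Real.toNNReal (σ ^ 2)) 8 (by simp)).comp_snd _
  · rw [gaussianMechanism_joint, gaussianMechanism_σ,
      integral_fun_snd (fun e : ℝ => e ^ 8), integral_pow_eight_gaussianReal,
      Real.coe_toNNReal _ (sq_nonneg σ)]
    simp only [probReal_univ, one_smul]
    rw [Real.mul_rpow (by norm_num) (by positivity),
      show ((σ ^ 2) ^ 4 : ℝ) = (σ ^ 2) ^ (4 : ℝ) by
        rw [show (4 : ℝ) = ((4 : ℕ) : ℝ) by norm_num, Real.rpow_natCast],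
      ← Real.rpow_mul (sq_nonneg σ)]
    norm_num only [Real.rpow_one]
    exact mul_le_mul_of_nonneg_right hκ (sq_nonneg σ)
  · rw [gaussianMechanism_secondMoment hS, gaussianMechanism_lawX]
  · simp [gaussianMechanism_joint, Measure.map_snd_prod]
  · rw [gaussianMechanism_joint]
    exact indepFun_prod (X := id) (Y := id) measurable_id measurable_id

end Construction

/-! ### Assouad's method for the missing data model -/

section DataLaw

variable {p K : ℕ}

lemma Mechanism.measurable_response (P : Mechanism p) :
    Measurable fun z : EuclideanSpace ℝ (Fin p) × ℝ => (z.1, inner ℝ z.1 P.β + z.2) := by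
  fun_prop

instance (P : Mechanism p) : IsProbabilityMeasure P.lawX := by
  have := P.isProb
  exact Measure.isProbabilityMeasure_map measurable_fst.aemeasurable

instance (P : Mechanism p) : IsProbabilityMeasure P.lawXY := by
  have := P.isProb
  exact Measure.isProbabilityMeasure_map P.measurable_response.aemeasurable

lemma measurable_observe (O : Finset (Fin p)) :
    Measurable fun z : EuclideanSpace ℝ (Fin p) × ℝ => (fun i : O => z.1 (i : Fin p), z.2) := by
  fun_prop

instance (P : Mechanism p) (O : Finset (Fin p)) : IsProbabilityMeasure (P.lawObs O) :=
  Measure.isProbabilityMeasure_map (measurable_observe O).aemeasurable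

/-- Divergence of the data when only the samples in which all of `S` is observed, and the
unlabelled samples, distinguish the two mechanisms. -/
lemma klBounded_dataLaw (D : Pattern p K) (N : ℕ) {P Q : Mechanism p} {r r' : ℝ}
    (S : Finset (Fin p)) (hobs : ∀ O, ¬ S ⊆ O → Q.lawObs O = P.lawObs O)
    (hXY : KLBounded P.lawXY Q.lawXY r) (hX : KLBounded P.lawX Q.lawX r') :
    KLBounded (D.dataLaw N P) (D.dataLaw N Q) (D.count S * r + N * r') := by
  have h1 : ∀ k, KLBounded (P.lawObs (D.O k)) (Q.lawObs (D.O k)) (if S ⊆ D.O k then r else 0) := by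
    intro k
    split_ifs with h
    · exact hXY.map (measurable_observe _)
    · rw [hobs _ h]
      exact KLBounded.refl _
  refine KLBounded.mono ((KLBounded.pi fun k =>
    KLBounded.pi fun _ : Fin (D.n k) => h1 k).prod (KLBounded.pi fun _ : Fin N => hX)) ?_
  simp [Pattern.count, Finset.sum_mul, ite_mul]

end DataLaw

/-- The sign `±1` encoded by a Boolean. -/
def boolSign (b : Bool) : ℝ := if b then 1 else -1

lemma boolSign_not (b : Bool) : boolSign (!b) = -boolSign b := by
  cases b <;> simp [boolSign]

lemma boolSign_sq (b : Bool) : boolSign b ^ 2 = 1 := by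
  cases b <;> simp [boolSign]

/-- Flip the `j`-th entry of a Boolean vector. -/
def flipAt {p : ℕ} (j : Fin p) (v : Fin p → Bool) : Fin p → Bool := Function.update v j (!v j)

@[simp] lemma flipAt_same {p : ℕ} (j : Fin p) (v : Fin p → Bool) : flipAt j v j = !v j := by
  simp [flipAt]

lemma flipAt_of_ne {p : ℕ} {i j : Fin p} (h : i ≠ j) (v : Fin p → Bool) : flipAt j v i = v i := by
  simp [flipAt, h]

lemma flipAt_involutive {p : ℕ} (j : Fin p) : Function.Involutive (flipAt j) := by
  intro v
  ext i
  by_cases h : i = j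
  · subst h; simp
  · simp [flipAt_of_ne h]

section Assouad

variable {p K : ℕ}

lemma norm_sub_sq_sub_norm_sub_sq {y b c : EuclideanSpace ℝ (Fin p)} {j : Fin p}
    (hj : c j = -b j) (h : ∀ i, i ≠ j → c i = b i) :
    ‖y - c‖ ^ 2 - ‖y - b‖ ^ 2 = 4 * b j * y j := by
  rw [EuclideanSpace.real_norm_sq_eq, EuclideanSpace.real_norm_sq_eq, ← Finset.sum_sub_distrib,
    Finset.sum_eq_single j]
  · simp only [PiLp.sub_apply, hj]; ring
  · intro i _ hi
    simp [h i hi]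
  · simp

lemma sum_sq_le_norm_sq (y : EuclideanSpace ℝ (Fin p)) (J : Finset (Fin p)) :
    ∑ j ∈ J, y j ^ 2 ≤ ‖y‖ ^ 2 := by
  rw [EuclideanSpace.real_norm_sq_eq]
  exact Finset.sum_le_sum_of_subset_of_nonneg (Finset.subset_univ _) fun _ _ _ => sq_nonneg _

/-- **Assouad's lemma** for a hypercube of mechanisms in the Gaussian class. -/
theorem le_minimaxRisk (D : Pattern p K) (N : ℕ) (a : ClassParams)
    (P : (Fin p → Bool) → Mechanism p) (J : Finset (Fin p)) {δ : ℝ} (hδ : δ ≠ 0)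
    (hP : ∀ v, MemOSSGauss a (P v)) (hβ : ∀ v, ∀ j ∈ J, (P v).β j = δ * boolSign (v j))
    (hflip : ∀ v, ∀ j ∈ J, ∀ i, i ≠ j → (P (flipAt j v)).β i = (P v).β i)
    (hKL : ∀ v, ∀ j ∈ J, KLBounded (D.dataLaw N (P v)) (D.dataLaw N (P (flipAt j v))) 1) :
    ENNReal.ofReal (J.card * (δ ^ 2 * Real.exp (-2))) ≤ D.minimaxRisk N a := by
  refine le_iInf₂ fun est hest => ?_
  set M : ℝ≥0∞ := ⨆ (P : Mechanism p) (_ : MemOSSGauss a P),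
    ∫⁻ x, ENNReal.ofReal (‖est x - P.β‖ ^ 2) ∂(D.dataLaw N P) with hM
  have hflipj : ∀ v, ∀ j ∈ J, (P (flipAt j v)).β j = -(P v).β j := by
    intro v j hj
    rw [hβ _ j hj, hβ _ j hj, flipAt_same, boolSign_not, mul_neg]
  have hmeas : ∀ j ∈ J, Measurable fun x => est x j := by
    intro j hj
    let v : Fin p → Bool := fun _ => true
    have hb : (P v).β j = δ := by simp [hβ v j hj, v, boolSign]
    -- Only distances from an estimator to the true coefficients are known to be measurable. Two
    -- coefficient vectors differing by a sign at `j` recover coordinate `j` of the estimator by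
    -- polarization.
    have h1 := hest _ (hP v).toMemOSS
    have h2 := hest _ (hP (flipAt j v)).toMemOSS
    have h3 : (fun x => est x j) = fun x =>
        (‖est x - (P (flipAt j v)).β‖ ^ 2 - ‖est x - (P v).β‖ ^ 2) / (4 * δ) := by
      ext x
      rw [norm_sub_sq_sub_norm_sub_sq (hflipj v j hj) (hflip v j hj), hb]
      field_simp
    rw [h3]
    fun_prop
  let A : (Fin p → Bool) → Fin p → ℝ≥0∞ := fun v j =>
    ∫⁻ x, ENNReal.ofReal ((est x j - (P v).β j) ^ 2) ∂(D.dataLaw N (P v))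
  have hA : ∀ v, ∑ j ∈ J, A v j ≤ M := by
    intro v
    refine le_trans ?_ (le_iSup₂_of_le (P v) (hP v) le_rfl)
    rw [← lintegral_finsetSum' _ fun j hj =>
      (((hmeas j hj).sub_const _).pow_const 2).ennreal_ofReal.aemeasurable]
    refine lintegral_mono fun x => ?_
    rw [← ENNReal.ofReal_sum_of_nonneg fun _ _ => sq_nonneg _]
    exact ENNReal.ofReal_le_ofReal (sum_sq_le_norm_sq (est x - (P v).β) J)
  have hpair : ∀ v, ∀ j ∈ J,
      ENNReal.ofReal (2 * (δ ^ 2 * Real.exp (-2))) ≤ A v j + A (flipAt j v) j := by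
    intro v j hj
    have h := (hKL v j hj).two_point (hmeas j hj) ((P v).β j)
    have h1 : (P v).β j ^ 2 = δ ^ 2 := by rw [hβ v j hj, mul_pow, boolSign_sq, mul_one]
    rw [h1, mul_assoc] at h
    simpa only [A, hflipj v j hj, sub_neg_eq_add] using h
  -- Flipping is a bijection of the cube, so the flipped terms have the same sum.
  have hsum : ∑ v, ∑ j ∈ J, (A v j + A (flipAt j v) j) = 2 * ∑ v, ∑ j ∈ J, A v j := by
    simp_rw [Finset.sum_add_distrib]
    rw [two_mul]
    congr 1
    rw [Finset.sum_comm, Finset.sum_comm (s := Finset.univ)]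
    refine Finset.sum_congr rfl fun j _ => ?_
    exact Equiv.sum_comp (flipAt_involutive j).toPerm fun v => A v j
  have hlow : (Fintype.card (Fin p → Bool) : ℝ≥0∞) *
      (J.card * ENNReal.ofReal (2 * (δ ^ 2 * Real.exp (-2)))) ≤
      ∑ v, ∑ j ∈ J, (A v j + A (flipAt j v) j) := by
    have := Finset.sum_le_sum fun v (_ : v ∈ (Finset.univ : Finset (Fin p → Bool))) =>
      Finset.sum_le_sum fun j hj => hpair v j hj
    simpa using this
  have hup : ∑ v, ∑ j ∈ J, A v j ≤ (Fintype.card (Fin p → Bool) : ℝ≥0∞) * M := by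
    have := Finset.sum_le_sum fun v (_ : v ∈ (Finset.univ : Finset (Fin p → Bool))) => hA v
    simpa using this
  have hcard : (Fintype.card (Fin p → Bool) : ℝ≥0∞) ≠ 0 := by
    simp
  have h1 : (Fintype.card (Fin p → Bool) : ℝ≥0∞) *
      (2 * ENNReal.ofReal (J.card * (δ ^ 2 * Real.exp (-2)))) ≤
      (Fintype.card (Fin p → Bool) : ℝ≥0∞) * (2 * M) := by
    calc _ = (Fintype.card (Fin p → Bool) : ℝ≥0∞) *
          (J.card * ENNReal.ofReal (2 * (δ ^ 2 * Real.exp (-2)))) := by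
          rw [ENNReal.ofReal_mul (Nat.cast_nonneg _), ENNReal.ofReal_mul zero_le_two,
            ENNReal.ofReal_natCast, ENNReal.ofReal_ofNat]
          ring
      _ ≤ 2 * ∑ v, ∑ j ∈ J, A v j := hlow.trans_eq hsum
      _ ≤ 2 * ((Fintype.card (Fin p → Bool) : ℝ≥0∞) * M) := by gcongr
      _ = _ := by ring
  rw [ENNReal.mul_le_mul_iff_right hcard (ENNReal.natCast_ne_top _),
    ENNReal.mul_le_mul_iff_right (by norm_num) (by norm_num)] at h1
  exact h1

end Assouad

/-! ### Reflections and isotropic covariates -/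

section Isotropic

variable {p : ℕ}

/-- Change the sign of the `j`-th coordinate. -/
noncomputable def reflectAt (j : Fin p) (x : EuclideanSpace ℝ (Fin p)) :
    EuclideanSpace ℝ (Fin p) := x - (2 * x j) • EuclideanSpace.single j 1

lemma measurable_reflectAt (j : Fin p) : Measurable (reflectAt j) := by
  unfold reflectAt
  fun_prop

@[simp] lemma reflectAt_same (j : Fin p) (x : EuclideanSpace ℝ (Fin p)) :
    reflectAt j x j = -x j := by
  simp [reflectAt]; ring

lemma reflectAt_of_ne {i j : Fin p} (h : i ≠ j) (x : EuclideanSpace ℝ (Fin p)) :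
    reflectAt j x i = x i := by
  simp [reflectAt, h]

lemma reflectAt_reflectAt (j : Fin p) (x : EuclideanSpace ℝ (Fin p)) :
    reflectAt j (reflectAt j x) = x := by
  ext i
  by_cases h : i = j
  · subst h; simp
  · simp [reflectAt_of_ne h]

lemma inner_reflectAt_left (j : Fin p) (x y : EuclideanSpace ℝ (Fin p)) :
    inner ℝ (reflectAt j x) y = inner ℝ x (reflectAt j y) := by
  simp only [PiLp.inner_apply]
  refine Finset.sum_congr rfl fun i _ => ?_
  by_cases h : i = j
  · subst h; simp
  · simp [reflectAt_of_ne h]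

lemma inner_reflectAt_reflectAt (j : Fin p) (x y : EuclideanSpace ℝ (Fin p)) :
    inner ℝ (reflectAt j x) (reflectAt j y) = inner ℝ x y := by
  rw [inner_reflectAt_left, reflectAt_reflectAt]

lemma norm_reflectAt (j : Fin p) (x : EuclideanSpace ℝ (Fin p)) : ‖reflectAt j x‖ = ‖x‖ := by
  rw [norm_eq_sqrt_real_inner, inner_reflectAt_reflectAt, ← norm_eq_sqrt_real_inner]

lemma norm_reflectAt_sub_sq (j : Fin p) (x : EuclideanSpace ℝ (Fin p)) :
    ‖reflectAt j x - x‖ ^ 2 = 4 * x j ^ 2 := by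
  rw [reflectAt, sub_sub_cancel_left, norm_neg, norm_smul, PiLp.norm_single, norm_one, mul_one,
    Real.norm_eq_abs, sq_abs]
  ring

lemma dotProduct_self_eq_norm_sq (θ : EuclideanSpace ℝ (Fin p)) :
    θ.ofLp ⬝ᵥ θ.ofLp = ‖θ‖ ^ 2 := by
  rw [EuclideanSpace.real_norm_sq_eq]
  exact Finset.sum_congr rfl fun i _ => (sq _).symm

lemma posSemidef_smul_one {l : ℝ} (hl : 0 ≤ l) :
    (l • (1 : Matrix (Fin p) (Fin p) ℝ)).PosSemidef := Matrix.PosSemidef.one.smul hl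

lemma dotProduct_smul_one_mulVec (l : ℝ) (x : Fin p → ℝ) :
    x ⬝ᵥ (l • (1 : Matrix (Fin p) (Fin p) ℝ)) *ᵥ x = l * (x ⬝ᵥ x) := by
  simp [smul_mulVec, dotProduct_smul]

lemma charFun_isotropic {l : ℝ} (hl : 0 ≤ l) (t : EuclideanSpace ℝ (Fin p)) :
    charFun (multivariateGaussian 0 (l • (1 : Matrix (Fin p) (Fin p) ℝ))) t =
      Complex.exp (-((l * ‖t‖ ^ 2 : ℝ) : ℂ) / 2) := by
  rw [charFun_multivariateGaussian (posSemidef_smul_one hl), dotProduct_smul_one_mulVec,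
    dotProduct_self_eq_norm_sq]
  simp [neg_div]

/-- The characteristic function depends on the norm alone, which reflections preserve. -/
lemma map_reflectAt_isotropic {l : ℝ} (hl : 0 ≤ l) (j : Fin p) :
    (multivariateGaussian 0 (l • (1 : Matrix (Fin p) (Fin p) ℝ))).map (reflectAt j) =
      multivariateGaussian 0 (l • (1 : Matrix (Fin p) (Fin p) ℝ)) := by
  have := Measure.isProbabilityMeasure_map
    (μ := multivariateGaussian 0 (l • (1 : Matrix (Fin p) (Fin p) ℝ)))
    (measurable_reflectAt j).aemeasurable
  refine eq_multivariateGaussian (posSemidef_smul_one hl) _ fun t => ?_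
  have h1 := charFun_isotropic hl (reflectAt j t)
  rw [charFun_apply] at h1
  rw [charFun_apply, integral_map (measurable_reflectAt j).aemeasurable
    (Measurable.aestronglyMeasurable (by fun_prop))]
  simp_rw [inner_reflectAt_left]
  rw [h1, norm_reflectAt, dotProduct_smul_one_mulVec, dotProduct_self_eq_norm_sq]

lemma integral_inner_sq_isotropic {l : ℝ} (hl : 0 ≤ l) (θ : EuclideanSpace ℝ (Fin p)) :
    ∫ x, inner ℝ x θ ^ 2 ∂(multivariateGaussian 0 (l • (1 : Matrix (Fin p) (Fin p) ℝ))) =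
      l * ‖θ‖ ^ 2 := by
  rw [integral_inner_sq_multivariateGaussian (posSemidef_smul_one hl), dotProduct_smul_one_mulVec,
    dotProduct_self_eq_norm_sq]

lemma gaussianMechanism_lawXY (S : Matrix (Fin p) (Fin p) ℝ) (β : EuclideanSpace ℝ (Fin p))
    (σ : ℝ) (hσ : 0 ≤ σ) : (gaussianMechanism S β σ hσ).lawXY =
      ((multivariateGaussian 0 S).prod (gaussianReal 0 (Real.toNNReal (σ ^ 2)))).map
        fun z => (z.1, inner ℝ z.1 β + z.2) := rfl

/-- Passing from β to β' amounts to shifting the noise by ⟨x, β' − β⟩ before forming the response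
with β. -/
lemma klBounded_lawXY_isotropic {l : ℝ} (hl : 0 ≤ l) {σ : ℝ} (hσ : 0 < σ)
    (β β' : EuclideanSpace ℝ (Fin p)) :
    KLBounded (gaussianMechanism (l • 1) β σ hσ.le).lawXY
      (gaussianMechanism (l • 1) β' σ hσ.le).lawXY (l * ‖β' - β‖ ^ 2 / (2 * σ ^ 2)) := by
  have hσ2 : Real.toNNReal (σ ^ 2) ≠ 0 := by simpa using hσ.ne'
  have h := (klBounded_shift hσ2 (f := fun x => inner ℝ x (β' - β)) (by fun_prop)
    (memLp_inner_multivariateGaussian (S := l • (1 : Matrix (Fin p) (Fin p) ℝ)) (β' - β))).map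
    (f := fun z => (z.1, inner ℝ z.1 β + z.2)) (by fun_prop)
  rw [integral_inner_sq_isotropic hl, Real.coe_toNNReal _ (sq_nonneg σ),
    Measure.map_map (by fun_prop) (by fun_prop)] at h
  rw [gaussianMechanism_lawXY, gaussianMechanism_lawXY]
  convert h using 2
  ext z : 1
  simp only [Function.comp, inner_sub_right]
  congr 1
  ring

/-- Reflecting X as well as β leaves the response and all observed coordinates unchanged, and X has
the same law as its reflection. -/
lemma lawObs_isotropic_reflectAt {l : ℝ} (hl : 0 ≤ l) {σ : ℝ} (hσ : 0 ≤ σ)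
    (β : EuclideanSpace ℝ (Fin p)) {j : Fin p} {O : Finset (Fin p)} (hj : j ∉ O) :
    (gaussianMechanism (l • 1) (reflectAt j β) σ hσ).lawObs O =
      (gaussianMechanism (l • 1) β σ hσ).lawObs O := by
  simp only [Mechanism.lawObs, gaussianMechanism_lawXY]
  rw [Measure.map_map (measurable_observe O) (by fun_prop),
    Measure.map_map (measurable_observe O) (by fun_prop)]
  nth_rewrite 1 [← map_reflectAt_isotropic hl j]
  nth_rewrite 1 [← Measure.map_id (μ := gaussianReal 0 (Real.toNNReal (σ ^ 2)))]
  rw [Measure.map_prod_map _ _ (measurable_reflectAt j) measurable_id,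
    Measure.map_map ((measurable_observe O).comp (by fun_prop))
      ((measurable_reflectAt j).prodMap measurable_id)]
  congr 1
  ext z : 1
  simp only [Function.comp, Prod.map, id, inner_reflectAt_reflectAt]
  congr 1
  ext i
  exact reflectAt_of_ne (fun h : (i : Fin p) = j => hj (h ▸ i.2)) _

end Isotropic

/-! ### Covariates correlated with a hub coordinate -/

section Hub

variable {p : ℕ}

/-- The matrix `l • 1 + e_h wᵀ + w e_hᵀ`. -/
noncomputable def hubMatrix (l : ℝ) (h : Fin p) (w : EuclideanSpace ℝ (Fin p)) :
    Matrix (Fin p) (Fin p) ℝ :=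
  l • 1 + (vecMulVec (Pi.single h 1) w.ofLp + vecMulVec w.ofLp (Pi.single h 1))

lemma dotProduct_hubMatrix_mulVec (l : ℝ) (h : Fin p) (w x : EuclideanSpace ℝ (Fin p)) :
    x.ofLp ⬝ᵥ hubMatrix l h w *ᵥ x.ofLp = l * ‖x‖ ^ 2 + 2 * (x h * inner ℝ x w) := by
  have h1 : w.ofLp ⬝ᵥ x.ofLp = inner ℝ x w := by
    simp [PiLp.inner_apply, dotProduct]
  rw [hubMatrix, add_mulVec, add_mulVec, dotProduct_add, dotProduct_add,
    dotProduct_smul_one_mulVec, dotProduct_self_eq_norm_sq, vecMulVec_mulVec, vecMulVec_mulVec, h1]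
  have h2 : x.ofLp ⬝ᵥ w.ofLp = inner ℝ x w := by rw [dotProduct_comm, h1]
  simp [h2]
  ring

/-- By Cauchy-Schwarz, the rank-two perturbation of the isotropic matrix has operator norm at most
2‖w‖. This controls the eigenvalues of `hubMatrix`. -/
lemma abs_hub_le {h : Fin p} {w : EuclideanSpace ℝ (Fin p)} {η : ℝ} (hη : 0 ≤ η)
    (hw : 4 * ‖w‖ ^ 2 ≤ η ^ 2) (x : EuclideanSpace ℝ (Fin p)) :
    |2 * (x h * inner ℝ x w)| ≤ η * ‖x‖ ^ 2 := by
  have h1 : |x h| ≤ ‖x‖ := by simpa using PiLp.norm_apply_le x h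
  have h2 : |inner ℝ x w| ≤ ‖x‖ * ‖w‖ := abs_real_inner_le_norm x w
  have h3 : 2 * ‖w‖ ≤ η := by
    refine le_of_sq_le_sq ?_ hη
    nlinarith
  rw [abs_mul, abs_mul, abs_two]
  have h4 := mul_le_mul h1 h2 (abs_nonneg _) (norm_nonneg x)
  have h5 := mul_le_mul_of_nonneg_right h3 (sq_nonneg ‖x‖)
  nlinarith

lemma le_dotProduct_hubMatrix {l η : ℝ} {h : Fin p} {w : EuclideanSpace ℝ (Fin p)} (hη : 0 ≤ η)
    (hw : 4 * ‖w‖ ^ 2 ≤ η ^ 2) (x : Fin p → ℝ) :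
    (l - η) * (x ⬝ᵥ x) ≤ x ⬝ᵥ hubMatrix l h w *ᵥ x := by
  have h1 := dotProduct_hubMatrix_mulVec l h w (WithLp.toLp 2 x)
  have h2 := dotProduct_self_eq_norm_sq (WithLp.toLp 2 x)
  have h3 := (abs_le.1 (abs_hub_le (h := h) hη hw (WithLp.toLp 2 x))).1
  simp only at h1 h2
  rw [h1, h2]
  linarith

lemma dotProduct_hubMatrix_le {l η : ℝ} {h : Fin p} {w : EuclideanSpace ℝ (Fin p)} (hη : 0 ≤ η)
    (hw : 4 * ‖w‖ ^ 2 ≤ η ^ 2) (x : Fin p → ℝ) :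
    x ⬝ᵥ hubMatrix l h w *ᵥ x ≤ (l + η) * (x ⬝ᵥ x) := by
  have h1 := dotProduct_hubMatrix_mulVec l h w (WithLp.toLp 2 x)
  have h2 := dotProduct_self_eq_norm_sq (WithLp.toLp 2 x)
  have h3 := (abs_le.1 (abs_hub_le (h := h) hη hw (WithLp.toLp 2 x))).2
  simp only at h1 h2
  rw [h1, h2]
  linarith

lemma posSemidef_hubMatrix {l : ℝ} (hl : 0 ≤ l) {h : Fin p} {w : EuclideanSpace ℝ (Fin p)}
    (hw : 4 * ‖w‖ ^ 2 ≤ l ^ 2) : (hubMatrix l h w).PosSemidef := by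
  refine Matrix.PosSemidef.of_dotProduct_mulVec_nonneg ?_ fun x => ?_
  · ext i j
    simp [hubMatrix, vecMulVec_apply, one_apply, eq_comm (a := i) (b := j)]
    ring
  · simpa using le_dotProduct_hubMatrix (l := l) (h := h) hl hw x

/-- The covariate vector built from an isotropic vector and an independent hub variable. -/
noncomputable def hubMap (l : ℝ) (h : Fin p) (w : EuclideanSpace ℝ (Fin p))
    (u : EuclideanSpace ℝ (Fin p) × ℝ) : EuclideanSpace ℝ (Fin p) :=
  u.1 + (u.2 - u.1 h + inner ℝ u.1 w / l) • EuclideanSpace.single h 1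

@[fun_prop]
lemma measurable_hubMap (l : ℝ) (h : Fin p) (w : EuclideanSpace ℝ (Fin p)) :
    Measurable (hubMap l h w) := by
  unfold hubMap
  fun_prop

lemma hubMap_same (l : ℝ) (h : Fin p) (w : EuclideanSpace ℝ (Fin p))
    (u : EuclideanSpace ℝ (Fin p) × ℝ) : hubMap l h w u h = u.2 + inner ℝ u.1 w / l := by
  simp [hubMap]; ring

lemma hubMap_of_ne (l : ℝ) {h i : Fin p} (hi : i ≠ h) (w : EuclideanSpace ℝ (Fin p))
    (u : EuclideanSpace ℝ (Fin p) × ℝ) : hubMap l h w u i = u.1 i := by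
  simp [hubMap, hi]

/-- The law of the covariates built by `hubMap`. -/
lemma map_hubMap {l : ℝ} (hl : 0 < l) {h : Fin p} {w : EuclideanSpace ℝ (Fin p)} (hwh : w h = 0)
    (hw : 4 * ‖w‖ ^ 2 ≤ l ^ 2) :
    ((multivariateGaussian 0 (l • (1 : Matrix (Fin p) (Fin p) ℝ))).prod
      (gaussianReal 0 (Real.toNNReal (l - ‖w‖ ^ 2 / l)))).map (hubMap l h w) =
      multivariateGaussian 0 (hubMatrix l h w) := by
  have hs : 0 ≤ l - ‖w‖ ^ 2 / l := by
    rw [sub_nonneg, div_le_iff₀ hl]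
    nlinarith [sq_nonneg ‖w‖]
  have hm := measurable_hubMap l h w
  have := Measure.isProbabilityMeasure_map
    (μ := (multivariateGaussian 0 (l • (1 : Matrix (Fin p) (Fin p) ℝ))).prod
      (gaussianReal 0 (Real.toNNReal (l - ‖w‖ ^ 2 / l)))) hm.aemeasurable
  refine eq_multivariateGaussian (posSemidef_hubMatrix hl.le hw) _ fun t => ?_
  set e : EuclideanSpace ℝ (Fin p) := EuclideanSpace.single h 1 with he
  have het : ∀ x : EuclideanSpace ℝ (Fin p), inner ℝ e x = x h := by
    intro x; simp [he, EuclideanSpace.inner_single_left]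
  have hte : ∀ x : EuclideanSpace ℝ (Fin p), inner ℝ x e = x h := by
    intro x; rw [real_inner_comm, het]
  -- `t'` collects the dependence of ⟨X, t⟩ on the isotropic vector. The residual variance l −
  -- ‖w‖²/l is what restores the entry l on the diagonal at the hub.
  set t' : EuclideanSpace ℝ (Fin p) := t + t h • (l⁻¹ • w - e) with ht'
  have hin : ∀ u : EuclideanSpace ℝ (Fin p) × ℝ,
      inner ℝ (hubMap l h w u) t = inner ℝ u.1 t' + t h * u.2 := by
    intro u
    simp only [hubMap, ht', inner_add_left, inner_add_right, inner_smul_left, inner_smul_right,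
      inner_sub_right, ← he, het, hte]
    simp only [conj_trivial]
    field_simp
    ring
  have hn : ‖t'‖ ^ 2 = ‖t‖ ^ 2 + 2 * (t h * (inner ℝ t w / l - t h)) +
      t h ^ 2 * (‖w‖ ^ 2 / l ^ 2 + 1) := by
    have he1 : ‖e‖ = 1 := by simp [he]
    rw [ht', norm_add_sq_real, norm_smul, mul_pow, norm_sub_sq_real, norm_smul, inner_smul_right,
      inner_sub_right, inner_smul_right, inner_smul_left, hte, hte, hwh, he1, mul_pow]
    simp only [Real.norm_eq_abs, sq_abs, mul_zero]
    field_simp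
    ring
  rw [charFun_apply, integral_map hm.aemeasurable
    (Measurable.aestronglyMeasurable (by fun_prop))]
  have hsplit : ∀ u : EuclideanSpace ℝ (Fin p) × ℝ,
      Complex.exp ((inner ℝ (hubMap l h w u) t : ℝ) * Complex.I) =
        Complex.exp ((inner ℝ u.1 t' : ℝ) * Complex.I) *
          Complex.exp (t h * u.2 * Complex.I) := by
    intro u
    rw [hin, ← Complex.exp_add]
    push_cast
    ring_nf
  simp_rw [hsplit]
  rw [integral_prod_mul (fun g : EuclideanSpace ℝ (Fin p) =>
    Complex.exp ((inner ℝ g t' : ℝ) * Complex.I))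
    (fun z : ℝ => Complex.exp (t h * z * Complex.I)), ← charFun_apply, ← charFun_apply_real,
    charFun_isotropic hl.le, charFun_gaussianReal, ← Complex.exp_add, dotProduct_hubMatrix_mulVec,
    hn, Real.coe_toNNReal _ hs]
  congr 1
  have hl' : (l : ℂ) ≠ 0 := by exact_mod_cast hl.ne'
  push_cast
  field_simp
  ring

/-- Covariates `N(0, l • 1 + e_h wᵀ + w e_hᵀ)` and coefficients `a (e_h - w / l)`, for which
`(Xᵢ)_{i ≠ h}` and `Y` are independent. -/
noncomputable def hubMechanism (l a : ℝ) (h : Fin p) (w : EuclideanSpace ℝ (Fin p)) (σ : ℝ)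
    (hσ : 0 ≤ σ) : Mechanism p :=
  gaussianMechanism (hubMatrix l h w) (a • (EuclideanSpace.single h 1 - l⁻¹ • w)) σ hσ

/-- Subtracting w/l removes exactly the part of the hub coordinate predicted by the others, so the
response sees only the residual `u.2`. -/
lemma inner_hubMap (l a : ℝ) {h : Fin p} {w : EuclideanSpace ℝ (Fin p)} (hwh : w h = 0)
    (u : EuclideanSpace ℝ (Fin p) × ℝ) :
    inner ℝ (hubMap l h w u) (a • (EuclideanSpace.single h 1 - l⁻¹ • w)) = a * u.2 := by
  have h1 : inner ℝ (hubMap l h w u) w = inner ℝ u.1 w := by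
    simp [hubMap, inner_add_left, inner_smul_left, EuclideanSpace.inner_single_left, hwh]
  have h2 : inner ℝ (hubMap l h w u) (EuclideanSpace.single h (1 : ℝ)) = hubMap l h w u h := by
    simp [EuclideanSpace.inner_single_right]
  rw [inner_smul_right, inner_sub_right, inner_smul_right, h1, h2, hubMap_same]
  ring

lemma hubMechanism_lawXY {l : ℝ} (hl : 0 < l) (a : ℝ) {h : Fin p} {w : EuclideanSpace ℝ (Fin p)}
    (hwh : w h = 0) (hw : 4 * ‖w‖ ^ 2 ≤ l ^ 2) {σ : ℝ} (hσ : 0 ≤ σ) :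
    (hubMechanism l a h w σ hσ).lawXY =
      (((multivariateGaussian 0 (l • (1 : Matrix (Fin p) (Fin p) ℝ))).prod
        (gaussianReal 0 (Real.toNNReal (l - ‖w‖ ^ 2 / l)))).prod
        (gaussianReal 0 (Real.toNNReal (σ ^ 2)))).map
        fun z => (hubMap l h w z.1, a * z.1.2 + z.2) := by
  rw [hubMechanism, gaussianMechanism_lawXY, ← map_hubMap hl hwh hw]
  nth_rewrite 1 [← Measure.map_id (μ := gaussianReal 0 (Real.toNNReal (σ ^ 2)))]
  rw [Measure.map_prod_map _ _ (measurable_hubMap l h w) measurable_id,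
    Measure.map_map (by fun_prop) ((measurable_hubMap l h w).prodMap measurable_id)]
  congr 1
  ext z : 1
  simp only [Function.comp, Prod.map, id, inner_hubMap l a hwh]

/-- A change of `w` is absorbed by shifting the residual by a function of the independent isotropic
vector, which puts both laws under one map. -/
lemma hubMap_shift (l : ℝ) (h : Fin p) (w w' : EuclideanSpace ℝ (Fin p))
    (u : EuclideanSpace ℝ (Fin p) × ℝ) :
    hubMap l h w (u.1, u.2 + inner ℝ u.1 (l⁻¹ • (w' - w))) = hubMap l h w' u := by
  simp only [hubMap, inner_smul_right, inner_sub_right]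
  congr 2
  ring

lemma klBounded_hubMechanism_lawX {l : ℝ} (hl : 0 < l) (a : ℝ) {h : Fin p}
    {w w' : EuclideanSpace ℝ (Fin p)} (hwh : w h = 0) (hwh' : w' h = 0) (hww' : ‖w'‖ = ‖w‖)
    (hw : 4 * ‖w‖ ^ 2 ≤ l ^ 2) {σ : ℝ} (hσ : 0 ≤ σ) :
    KLBounded (hubMechanism l a h w σ hσ).lawX (hubMechanism l a h w' σ hσ).lawX
      (l * ‖l⁻¹ • (w' - w)‖ ^ 2 / (2 * (l - ‖w‖ ^ 2 / l))) := by
  have hs : 0 < l - ‖w‖ ^ 2 / l := by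
    rw [sub_pos, div_lt_iff₀ hl]
    nlinarith [sq_nonneg ‖w‖]
  have hs' : Real.toNNReal (l - ‖w‖ ^ 2 / l) ≠ 0 := by simpa using hs
  have hk := (klBounded_shift hs' (f := fun x => inner ℝ x (l⁻¹ • (w' - w))) (by fun_prop)
    (memLp_inner_multivariateGaussian (S := l • (1 : Matrix (Fin p) (Fin p) ℝ))
      (l⁻¹ • (w' - w)))).map (measurable_hubMap l h w)
  rw [integral_inner_sq_isotropic hl.le, Real.coe_toNNReal _ hs.le,
    Measure.map_map (by fun_prop) (by fun_prop)] at hk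
  rw [hubMechanism, hubMechanism, gaussianMechanism_lawX, gaussianMechanism_lawX,
    ← map_hubMap hl hwh hw, ← map_hubMap hl hwh' (hww' ▸ hw), hww']
  convert hk using 2
  ext u : 1
  exact (hubMap_shift l h w w' u).symm

lemma klBounded_hubMechanism_lawXY {l : ℝ} (hl : 0 < l) (a : ℝ) {h : Fin p}
    {w w' : EuclideanSpace ℝ (Fin p)} (hwh : w h = 0) (hwh' : w' h = 0) (hww' : ‖w'‖ = ‖w‖)
    (hw : 4 * ‖w‖ ^ 2 ≤ l ^ 2) {σ : ℝ} (hσ : 0 < σ) :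
    KLBounded (hubMechanism l a h w σ hσ.le).lawXY (hubMechanism l a h w' σ hσ.le).lawXY
      (l * ‖l⁻¹ • (w' - w)‖ ^ 2 / (2 * (l - ‖w‖ ^ 2 / l)) +
        a ^ 2 * (l * ‖l⁻¹ • (w' - w)‖ ^ 2) / (2 * σ ^ 2)) := by
  have hs : 0 < l - ‖w‖ ^ 2 / l := by
    rw [sub_pos, div_lt_iff₀ hl]
    nlinarith [sq_nonneg ‖w‖]
  have hs' : Real.toNNReal (l - ‖w‖ ^ 2 / l) ≠ 0 := by simpa using hs
  have hσ2 : Real.toNNReal (σ ^ 2) ≠ 0 := by simpa using hσ.ne'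
  have hmem := memLp_inner_multivariateGaussian (S := l • (1 : Matrix (Fin p) (Fin p) ℝ))
    (l⁻¹ • (w' - w))
  -- The response is `a` times the residual plus noise. Shifting the residual by f must leave it
  -- unchanged, so the noise is shifted by −a f. Equal norms of `w` and `w'` give equal residual
  -- variances.
  have hk := (klBounded_shift_shift hs' hσ2 (f := fun x => inner ℝ x (l⁻¹ • (w' - w)))
    (g := fun x => -a * inner ℝ x (l⁻¹ • (w' - w))) (by fun_prop) (by fun_prop) hmem
    (hmem.const_mul (-a))).map (f := fun z => (hubMap l h w z.1, a * z.1.2 + z.2)) (by fun_prop)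
  simp_rw [mul_pow, neg_sq] at hk
  rw [integral_const_mul, integral_inner_sq_isotropic hl.le, Real.coe_toNNReal _ hs.le,
    Real.coe_toNNReal _ (sq_nonneg σ), Measure.map_map (by fun_prop) (by fun_prop)] at hk
  rw [hubMechanism_lawXY hl a hwh hw, hubMechanism_lawXY hl a hwh' (hww' ▸ hw), hww']
  convert hk using 2
  ext z : 1
  refine Prod.ext (hubMap_shift l h w w' z.1).symm ?_
  simp only [Function.comp]
  ring

lemma lawObs_hubMechanism_reflectAt {l : ℝ} (hl : 0 < l) (a : ℝ) {h j : Fin p} (hj : j ≠ h)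
    {w : EuclideanSpace ℝ (Fin p)} (hwh : w h = 0) (hw : 4 * ‖w‖ ^ 2 ≤ l ^ 2) {σ : ℝ} (hσ : 0 ≤ σ)
    {O : Finset (Fin p)} (hO : ¬ {h, j} ⊆ O) :
    (hubMechanism l a h (reflectAt j w) σ hσ).lawObs O =
      (hubMechanism l a h w σ hσ).lawObs O := by
  have hm : ∀ w : EuclideanSpace ℝ (Fin p), Measurable
      fun z : (EuclideanSpace ℝ (Fin p) × ℝ) × ℝ => (hubMap l h w z.1, a * z.1.2 + z.2) := by
    intro w; fun_prop
  simp only [Mechanism.lawObs]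
  rw [hubMechanism_lawXY hl a hwh hw, hubMechanism_lawXY hl a
    (by rw [reflectAt_of_ne hj.symm, hwh]) (by rw [norm_reflectAt]; exact hw), norm_reflectAt,
    Measure.map_map (measurable_observe O) (hm _), Measure.map_map (measurable_observe O) (hm _)]
  -- With the hub observed, `j` is not, and reflecting coordinate `j` of the isotropic vector
  -- compensates the sign. With the hub unobserved, no observed quantity involves `w` except through
  -- its norm.
  by_cases hh : h ∈ O
  · have hjO : j ∉ O := fun hjO => hO (by simp [Finset.insert_subset_iff, hh, hjO])
    nth_rewrite 1 [← map_reflectAt_isotropic hl.le j]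
    nth_rewrite 1 [← Measure.map_id (μ := gaussianReal 0 (Real.toNNReal (l - ‖w‖ ^ 2 / l)))]
    nth_rewrite 1 [← Measure.map_id (μ := gaussianReal 0 (Real.toNNReal (σ ^ 2)))]
    rw [Measure.map_prod_map _ _ (measurable_reflectAt j) measurable_id,
      Measure.map_prod_map _ _ ((measurable_reflectAt j).prodMap measurable_id) measurable_id,
      Measure.map_map ((measurable_observe O).comp (hm _))
        (((measurable_reflectAt j).prodMap measurable_id).prodMap measurable_id)]
    congr 1
    ext z : 1
    simp only [Function.comp, Prod.map, id]
    congr 1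
    ext i
    have hij : (i : Fin p) ≠ j := fun e => hjO (e ▸ i.2)
    by_cases hi : (i : Fin p) = h
    · rw [hi, hubMap_same, hubMap_same, inner_reflectAt_reflectAt]
    · rw [hubMap_of_ne l hi, hubMap_of_ne l hi, reflectAt_of_ne hij]
  · congr 1
    ext z : 1
    simp only [Function.comp]
    congr 1
    ext i
    have hi : (i : Fin p) ≠ h := fun e => hh (e ▸ i.2)
    rw [hubMap_of_ne l hi, hubMap_of_ne l hi]

end Hub

/-! ### Lower bounds from two hypercubes of mechanisms -/

section Cube

variable {p : ℕ}

/-- The vector with entries `±τ` on `J`, with signs encoded by `v`, and `0` elsewhere. -/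
noncomputable def cubeVec (J : Finset (Fin p)) (τ : ℝ) (v : Fin p → Bool) :
    EuclideanSpace ℝ (Fin p) := WithLp.toLp 2 fun i => if i ∈ J then τ * boolSign (v i) else 0

lemma cubeVec_of_mem {J : Finset (Fin p)} {i : Fin p} (hi : i ∈ J) (τ : ℝ) (v : Fin p → Bool) :
    cubeVec J τ v i = τ * boolSign (v i) := by
  simp [cubeVec, hi]

lemma cubeVec_of_notMem {J : Finset (Fin p)} {i : Fin p} (hi : i ∉ J) (τ : ℝ) (v : Fin p → Bool) :
    cubeVec J τ v i = 0 := by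
  simp [cubeVec, hi]

lemma norm_cubeVec_sq (J : Finset (Fin p)) (τ : ℝ) (v : Fin p → Bool) :
    ‖cubeVec J τ v‖ ^ 2 = J.card * τ ^ 2 := by
  rw [EuclideanSpace.real_norm_sq_eq]
  simp [cubeVec, ite_pow, mul_pow, boolSign_sq]

lemma cubeVec_flipAt {J : Finset (Fin p)} {j : Fin p} (hj : j ∈ J) (τ : ℝ) (v : Fin p → Bool) :
    cubeVec J τ (flipAt j v) = reflectAt j (cubeVec J τ v) := by
  ext i
  by_cases h : i = j
  · subst h
    simp [cubeVec_of_mem hj, boolSign_not]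
  · rw [reflectAt_of_ne h]
    simp [cubeVec, flipAt_of_ne h]

lemma norm_cubeVec_flipAt_sub_sq {J : Finset (Fin p)} {j : Fin p} (hj : j ∈ J) (τ : ℝ)
    (v : Fin p → Bool) : ‖cubeVec J τ (flipAt j v) - cubeVec J τ v‖ ^ 2 = 4 * τ ^ 2 := by
  rw [cubeVec_flipAt hj, norm_reflectAt_sub_sq, cubeVec_of_mem hj, mul_pow, boolSign_sq, mul_one]

end Cube

/-- The conditions on the parameters of the model class. -/
structure ClassParams.Admissible (a : ClassParams) : Prop where
  R_pos : 0 < a.R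
  B_pos : 0 < a.B
  χ_pos : 0 < a.χ
  χ_le : a.χ ≤ 1
  one_le_C : 1 ≤ a.C
  lamMin_pos : 0 < a.lamMin
  lamMin_lt : a.lamMin < a.lamMax
  sqrt_le_CX : Real.sqrt (8 * a.lamMax / 3) ≤ a.CX
  le_κ : (105 : ℝ) ^ (1 / 4 : ℝ) ≤ a.κ

section LowerBounds

variable {p K : ℕ} {a : ClassParams} (D : Pattern p K) (N : ℕ)

/-- The lower bound obtained from isotropic covariates and perturbed coefficients. -/
lemma isotropic_lower_bound (ha : a.Admissible) {τ : ℝ} (hτ : 0 < τ) (hB : p * τ ^ 2 ≤ a.B ^ 2)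
    (hcount : ∀ j, D.count {j} * (2 * a.lamMin * τ ^ 2 / a.R ^ 2) ≤ 1) :
    ENNReal.ofReal (p * (τ ^ 2 * Real.exp (-2))) ≤ D.minimaxRisk N a := by
  have hl := ha.lamMin_pos
  have hR := ha.R_pos
  have h := le_minimaxRisk D N a
    (fun v => gaussianMechanism (a.lamMin • 1) (cubeVec Finset.univ τ v) a.R hR.le) Finset.univ
    hτ.ne' ?_ ?_ ?_ ?_
  · simpa using h
  · intro v
    refine memOSSGauss_gaussianMechanism ha.χ_pos ha.χ_le ha.one_le_C hl ha.lamMin_lt ha.sqrt_le_CX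
      ha.le_κ (posSemidef_smul_one hl.le) (fun x => (dotProduct_smul_one_mulVec _ x).ge)
      (fun x => ?_) ?_ le_rfl
    · rw [dotProduct_smul_one_mulVec]
      refine mul_le_mul_of_nonneg_right ha.lamMin_lt.le ?_
      simpa using dotProduct_star_self_nonneg x
    · refine le_of_sq_le_sq ?_ ha.B_pos.le
      rw [norm_cubeVec_sq]
      simpa using hB
  · intro v j hj
    exact cubeVec_of_mem hj _ _
  · intro v j hj i hi
    simp only [gaussianMechanism_β]
    rw [cubeVec_flipAt hj, reflectAt_of_ne hi]
  · intro v j hj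
    refine (klBounded_dataLaw D N {j} (fun O hO => ?_)
      (klBounded_lawXY_isotropic hl.le hR _ _) (r' := 0) ?_).mono ?_
    · rw [cubeVec_flipAt hj]
      exact lawObs_isotropic_reflectAt hl.le hR.le _ (by simpa using hO)
    · simp only [gaussianMechanism_lawX]
      exact KLBounded.refl _
    · rw [norm_cubeVec_flipAt_sub_sq hj, mul_zero, add_zero]
      refine le_trans (le_of_eq ?_) (hcount j)
      field_simp
      ring

/-- The lower bound obtained from covariates with unknown correlations with the coordinate `h`. -/
lemma hub_lower_bound (ha : a.Admissible) {h : Fin p} {J : Finset (Fin p)} (hJ : h ∉ J) {l τ : ℝ}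
    (hl : l = (a.lamMin + a.lamMax) / 2) (hτ : 0 < τ)
    (hη : 4 * (J.card * τ ^ 2) ≤ ((a.lamMax - a.lamMin) / 2) ^ 2)
    (hcount : ∀ j ∈ J, (D.count {h, j} + N) * (4 * τ ^ 2 / l ^ 2) +
      D.count {h, j} * (a.B ^ 2 * τ ^ 2 / (2 * l * a.R ^ 2)) ≤ 1) :
    ENNReal.ofReal (J.card * ((a.B * τ / (2 * l)) ^ 2 * Real.exp (-2))) ≤ D.minimaxRisk N a := by
  have hl0 : 0 < l := by linarith [ha.lamMin_pos, ha.lamMin_lt]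
  have hR := ha.R_pos
  have hBp := ha.B_pos
  have hη0 : 0 ≤ (a.lamMax - a.lamMin) / 2 := by linarith [ha.lamMin_lt]
  have hηl : (a.lamMax - a.lamMin) / 2 ≤ l := by linarith [ha.lamMin_pos]
  have hw : ∀ v, 4 * ‖cubeVec J τ v‖ ^ 2 ≤ ((a.lamMax - a.lamMin) / 2) ^ 2 := by
    intro v; rw [norm_cubeVec_sq]; exact hη
  have hwl : ∀ v, 4 * ‖cubeVec J τ v‖ ^ 2 ≤ l ^ 2 := fun v =>
    (hw v).trans (pow_le_pow_left₀ hη0 hηl 2)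
  have hwh : ∀ v, cubeVec J τ v h = 0 := fun v => cubeVec_of_notMem hJ _ _
  have hnorm : ∀ v j, j ∈ J → ‖cubeVec J τ (flipAt j v)‖ = ‖cubeVec J τ v‖ := by
    intro v j hj; rw [cubeVec_flipAt hj, norm_reflectAt]
  have hmain := le_minimaxRisk D N a
    (fun v => hubMechanism l (a.B / 2) h (cubeVec J τ v) a.R hR.le) J
    -- Coordinate `j` of the coefficients is −(B/2) w_j / l, hence the minus sign.
    (δ := -(a.B * τ / (2 * l))) (neg_ne_zero.2 (by positivity)) ?_ ?_ ?_ ?_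
  · simpa only [neg_sq] using hmain
  · intro v
    refine memOSSGauss_gaussianMechanism ha.χ_pos ha.χ_le ha.one_le_C ha.lamMin_pos ha.lamMin_lt
      ha.sqrt_le_CX ha.le_κ (posSemidef_hubMatrix hl0.le (hwl v)) (fun x => ?_)
      (fun x => ?_) ?_ le_rfl
    · have := le_dotProduct_hubMatrix (l := l) (h := h) hη0 (hw v) x
      rwa [show l - (a.lamMax - a.lamMin) / 2 = a.lamMin by rw [hl]; ring] at this
    · have := dotProduct_hubMatrix_le (l := l) (h := h) hη0 (hw v) x
      rwa [show l + (a.lamMax - a.lamMin) / 2 = a.lamMax by rw [hl]; ring] at this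
    -- The scale B/2 is chosen because e_h − w/l has norm at most 2.
    · have h1 : ‖cubeVec J τ v‖ ≤ l := by
        refine le_of_sq_le_sq ?_ hl0.le
        nlinarith [hwl v, sq_nonneg ‖cubeVec J τ v‖]
      have h2 : ‖l⁻¹ • cubeVec J τ v‖ ≤ 1 := by
        rw [norm_smul, norm_inv, Real.norm_of_nonneg hl0.le, inv_mul_le_iff₀ hl0, mul_one]
        exact h1
      have h3 := norm_sub_le (EuclideanSpace.single h (1 : ℝ)) (l⁻¹ • cubeVec J τ v)
      rw [PiLp.norm_single, norm_one] at h3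
      rw [norm_smul, Real.norm_of_nonneg (by positivity)]
      nlinarith
  · intro v j hj
    have hjh : j ≠ h := fun e => hJ (e ▸ hj)
    simp [hubMechanism, hjh, cubeVec_of_mem hj]
    field_simp
  · intro v j hj i hi
    simp only [hubMechanism, gaussianMechanism_β, cubeVec_flipAt hj]
    simp [reflectAt_of_ne hi]
  · intro v j hj
    have hjh : j ≠ h := fun e => hJ (e ▸ hj)
    refine (klBounded_dataLaw D N {h, j} (fun O hO => ?_)
      (klBounded_hubMechanism_lawXY hl0 _ (hwh v) (hwh _) (hnorm v j hj) (hwl v) hR)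
      (klBounded_hubMechanism_lawX hl0 _ (hwh v) (hwh _) (hnorm v j hj) (hwl v) hR.le)).mono ?_
    · rw [cubeVec_flipAt hj]
      exact lawObs_hubMechanism_reflectAt hl0 _ hjh (hwh v) (hwl v) hR.le hO
    · rw [norm_smul, mul_pow, norm_cubeVec_flipAt_sub_sq hj, norm_inv,
        Real.norm_of_nonneg hl0.le]
      have hs : l / 2 ≤ l - ‖cubeVec J τ v‖ ^ 2 / l := by
        have : ‖cubeVec J τ v‖ ^ 2 / l ≤ l / 2 := by
          rw [div_le_iff₀ hl0]
          nlinarith [hwl v, sq_nonneg ‖cubeVec J τ v‖]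
        linarith
      have hT : l * (l⁻¹ ^ 2 * (4 * τ ^ 2)) / (2 * (l - ‖cubeVec J τ v‖ ^ 2 / l)) ≤
          4 * τ ^ 2 / l ^ 2 := by
        have e : 4 * τ ^ 2 / l ^ 2 = l * (l⁻¹ ^ 2 * (4 * τ ^ 2)) / (2 * (l / 2)) := by
          field_simp
        rw [e]
        exact div_le_div_of_nonneg_left (by positivity) (by positivity) (by linarith)
      have e2 : (a.B / 2) ^ 2 * (l * (l⁻¹ ^ 2 * (4 * τ ^ 2))) / (2 * a.R ^ 2) =
          a.B ^ 2 * τ ^ 2 / (2 * l * a.R ^ 2) := by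
        field_simp
        norm_num
      rw [e2]
      refine le_trans ?_ (hcount j hj)
      have h1 := mul_le_mul_of_nonneg_left hT (Nat.cast_nonneg (α := ℝ) (D.count {h, j}))
      have h2 := mul_le_mul_of_nonneg_left hT (Nat.cast_nonneg (α := ℝ) N)
      linarith

end LowerBounds

/-! ### Modalities -/

section Modality

variable {p K L : ℕ} {D : Pattern p K} {ξ : Fin p → Fin L}

/-- A union of blocks containing one variable contains its whole block; so counts for one or two
variables are the modality and cross-modality sample sizes. -/
lemma mem_iff_block_subset (hξ : D.IsBlockPartition ξ) (j : Fin p) (k : Fin K) :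
    j ∈ D.O k ↔ Pattern.block ξ (ξ j) ⊆ D.O k := by
  obtain ⟨G, hG⟩ := hξ.union k
  constructor
  · intro hj i hi
    rw [hG, Finset.mem_biUnion] at hj ⊢
    obtain ⟨g, hg, hjg⟩ := hj
    refine ⟨g, hg, ?_⟩
    simp only [Pattern.block, Finset.mem_filter, Finset.mem_univ, true_and] at hi hjg ⊢
    rw [hi, hjg]
  · intro hsub
    exact hsub (by simp [Pattern.block])

lemma count_singleton (hξ : D.IsBlockPartition ξ) (j : Fin p) :
    D.count {j} = D.h ξ (ξ j) := by
  simp [Pattern.h, Pattern.count, ← mem_iff_block_subset hξ]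

lemma count_pair (hξ : D.IsBlockPartition ξ) (i j : Fin p) :
    D.count {i, j} = D.nCross ξ (ξ i) (ξ j) := by
  simp [Pattern.nCross, Pattern.count, Finset.union_subset_iff, Finset.insert_subset_iff,
    ← mem_iff_block_subset hξ]

lemma exists_block_card_le (hL : 2 ≤ L) (ξ : Fin p → Fin L) :
    ∃ g, 2 * (Pattern.block ξ g).card ≤ p := by
  have hne : (⟨0, by omega⟩ : Fin L) ≠ ⟨1, by omega⟩ := by simp
  have hd : Disjoint (Pattern.block ξ ⟨0, by omega⟩) (Pattern.block ξ ⟨1, by omega⟩) := by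
    rw [Finset.disjoint_left]
    intro i h0 h1
    simp only [Pattern.block, Finset.mem_filter, Finset.mem_univ, true_and] at h0 h1
    exact hne (h0.symm.trans h1)
  have hc := Finset.card_le_univ
    (Pattern.block ξ ⟨0, by omega⟩ ∪ Pattern.block ξ ⟨1, by omega⟩)
  rw [Finset.card_union_of_disjoint hd, Fintype.card_fin] at hc
  by_contra! hcon
  have h0 := hcon ⟨0, by omega⟩
  have h1 := hcon ⟨1, by omega⟩
  omega

end Modality

/-! ### Choice of the amplitudes under the balance conditions -/

section Balanced

variable {p K L N : ℕ} {a : ClassParams} {D : Pattern p K} {ξ : Fin p → Fin L} {ρ Cρ : ℝ}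

/-- The contribution of the unknown coefficients to the minimax risk. -/
lemma coefficient_lower_bound (ha : a.Admissible) (hξ : D.IsBlockPartition ξ)
    (hD : D.IsBalanced ξ ρ Cρ) (hn : 0 < ρ * D.nLab) (hC : 1 ≤ Cρ)
    (hp : p * (a.R ^ 2 / (4 * a.B ^ 2 * a.lamMin)) ≤ ρ * D.nLab) :
    ENNReal.ofReal (Real.exp (-2) / 4 *
      (1 / (Cρ * a.lamMin) * (a.R ^ 2 * p / (ρ * D.nLab)))) ≤ D.minimaxRisk N a := by
  have hl := ha.lamMin_pos
  have hR := ha.R_pos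
  have hB := ha.B_pos
  have hC0 : 0 < Cρ := by linarith
  have hup := fun j => hD.h_upper (ξ j)
  simp_rw [← count_singleton hξ] at hup
  rw [mul_assoc] at hup
  generalize ρ * (D.nLab : ℝ) = m at *
  -- At most Cρ m samples observe a given variable, each contributing 2λ₋τ²/R²; this τ makes the
  -- total at most 1/2.
  set τ : ℝ := Real.sqrt (a.R ^ 2 / (4 * a.lamMin * Cρ * m)) with hτ
  have hτ2 : τ ^ 2 = a.R ^ 2 / (4 * a.lamMin * Cρ * m) := Real.sq_sqrt (by positivity)
  have hτ0 : 0 < τ := Real.sqrt_pos.2 (by positivity)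
  have hBτ : p * τ ^ 2 ≤ a.B ^ 2 := by
    have h1 : p * a.R ^ 2 ≤ 4 * a.B ^ 2 * a.lamMin * m := by
      rw [← mul_div_assoc, div_le_iff₀ (by positivity)] at hp
      linarith
    have h2 : 4 * a.B ^ 2 * a.lamMin * m ≤ Cρ * (4 * a.B ^ 2 * a.lamMin * m) :=
      le_mul_of_one_le_left (by positivity) hC
    rw [hτ2, ← mul_div_assoc, div_le_iff₀ (by positivity)]
    linarith
  refine le_trans (le_of_eq ?_) (isotropic_lower_bound D N ha hτ0 hBτ fun j => ?_)
  · congr 1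
    rw [hτ2]
    field_simp
  · have e : 2 * a.lamMin * τ ^ 2 / a.R ^ 2 = 1 / (2 * (Cρ * m)) := by
      rw [hτ2]
      field_simp
      norm_num
    rw [e, mul_one_div, div_le_one (by positivity)]
    have := hup j
    have : 0 < Cρ * m := by positivity
    linarith

/-- The contribution of the unknown covariance matrix to the minimax risk. -/
lemma covariance_lower_bound (ha : a.Admissible) (hL : 2 ≤ L) (hξ : D.IsBlockPartition ξ)
    (hD : D.IsBalanced ξ ρ Cρ) (hn : 0 < ρ ^ 2 * D.nLab) (hC : 1 ≤ Cρ)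
    (hp : (p : ℝ) * (min 1 (a.lamMax ^ 2) / (2 * a.B ^ 2 * (a.lamMax - a.lamMin) ^ 2)) ≤
      max ((N + ρ ^ 2 * D.nLab) / a.B ^ 2) (ρ ^ 2 * D.nLab / a.R ^ 2)) :
    ENNReal.ofReal (Real.exp (-2) / 256 * (min (a.lamMax ^ 2)⁻¹ 1 / Cρ *
      min (a.B ^ 2 * p / (N + ρ ^ 2 * D.nLab)) (a.R ^ 2 * p / (ρ ^ 2 * D.nLab)))) ≤
      D.minimaxRisk N a := by
  have hlm := ha.lamMin_pos
  have hlt := ha.lamMin_lt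
  have hR := ha.R_pos
  have hB := ha.B_pos
  have hC0 : 0 < Cρ := by linarith
  have hlM : 0 < a.lamMax := hlm.trans hlt
  obtain ⟨g, hg⟩ := exists_block_card_le hL ξ
  obtain ⟨h, hh⟩ := hξ.surj g
  -- Placing the hub in a modality with at most half of the variables leaves at least p/2 signs to
  -- be estimated.
  set J : Finset (Fin p) := (Pattern.block ξ g)ᶜ with hJ
  have hJcard : (p : ℝ) / 2 ≤ J.card := by
    have h1 : J.card = p - (Pattern.block ξ g).card := by
      rw [hJ, Finset.card_compl, Fintype.card_fin]
    have h2 : p ≤ 2 * J.card := by omega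
    have h3 : (p : ℝ) ≤ 2 * J.card := by exact_mod_cast h2
    linarith
  have hJp : (J.card : ℝ) ≤ p := by
    have := Finset.card_le_univ J
    rw [Fintype.card_fin] at this
    exact_mod_cast this
  have hhJ : h ∉ J := by simp [hJ, Pattern.block, hh]
  have hup : ∀ j ∈ J, (D.count {h, j} : ℝ) ≤ Cρ * (ρ ^ 2 * D.nLab) := by
    intro j hj
    rw [count_pair hξ, ← mul_assoc]
    refine hD.cross_upper _ _ fun e => ?_
    simp only [hJ, Pattern.block, Finset.mem_compl, Finset.mem_filter, Finset.mem_univ,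
      true_and] at hj
    exact hj (e.symm.trans hh)
  generalize ρ ^ 2 * (D.nLab : ℝ) = q at *
  have hNq : 0 < N + q := by positivity
  set M : ℝ := max ((N + q) / a.B ^ 2) (q / a.R ^ 2) with hM
  have hM1 : N + q ≤ M * a.B ^ 2 := (div_le_iff₀ (by positivity)).1 (le_max_left _ _)
  have hM2 : q ≤ M * a.R ^ 2 := (div_le_iff₀ (by positivity)).1 (le_max_right _ _)
  have hM0 : 0 < M := lt_of_lt_of_le (by positivity) (le_max_right _ _)
  have hMp : min (a.B ^ 2 * p / (N + q)) (a.R ^ 2 * p / q) ≤ p / M := by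
    rcases le_total ((N + q) / a.B ^ 2) (q / a.R ^ 2) with hle | hle
    · refine (min_le_right _ _).trans (le_of_eq ?_)
      rw [hM, max_eq_right hle]
      field_simp
    · refine (min_le_left _ _).trans (le_of_eq ?_)
      rw [hM, max_eq_left hle]
      field_simp
  set μ : ℝ := min 1 (a.lamMax ^ 2) with hμ
  have hμ0 : 0 < μ := lt_min one_pos (by positivity)
  have hμ2 : μ ≤ a.lamMax ^ 2 := min_le_right _ _
  have hμ1 : μ ≤ a.lamMax := by
    rcases le_total a.lamMax 1 with h1 | h1
    · exact hμ2.trans (by nlinarith)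
    · exact (min_le_left _ _).trans h1
  have hμinv : min (a.lamMax ^ 2)⁻¹ 1 = μ / a.lamMax ^ 2 := by
    rw [hμ, ← min_div_div_right (sq_nonneg a.lamMax), one_div, div_self (by positivity)]
  set l : ℝ := (a.lamMin + a.lamMax) / 2 with hl
  have hl0 : 0 < l := by positivity
  have hl1 : a.lamMax ≤ 2 * l := by linarith
  have hl2 : l ≤ a.lamMax := by linarith
  -- The factor 32 makes the eigenvalue constraint follow from the assumption on M. The factor μ ≤
  -- min(λ₊, λ₊²) with λ₊ ≤ 2l keeps each of the two divergence contributions below 1/2.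
  set τ : ℝ := Real.sqrt (μ / (32 * Cρ * (M * a.B ^ 2))) with hτ
  have hτ2 : τ ^ 2 = μ / (32 * Cρ * (M * a.B ^ 2)) := Real.sq_sqrt (by positivity)
  have hτ0 : 0 < τ := Real.sqrt_pos.2 (by positivity)
  refine le_trans (ENNReal.ofReal_le_ofReal ?_)
    (hub_lower_bound D N ha hhJ hl hτ0 ?_ fun j hj => ?_)
  · have h1 : (a.B * τ / (2 * l)) ^ 2 = μ / l ^ 2 / (128 * Cρ * M) := by
      rw [div_pow, mul_pow, hτ2]
      field_simp
      norm_num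
    have h2 : μ / a.lamMax ^ 2 ≤ μ / l ^ 2 :=
      div_le_div_of_nonneg_left hμ0.le (by positivity) (pow_le_pow_left₀ hl0.le hl2 2)
    rw [h1, hμinv]
    calc Real.exp (-2) / 256 * (μ / a.lamMax ^ 2 / Cρ *
          min (a.B ^ 2 * p / (N + q)) (a.R ^ 2 * p / q))
        ≤ Real.exp (-2) / 256 * (μ / l ^ 2 / Cρ * (p / M)) := by gcongr
      _ = p / 2 * (μ / l ^ 2 / (128 * Cρ * M) * Real.exp (-2)) := by
        field_simp
        ring
      _ ≤ _ := by gcongr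
  · have h1 : p * (μ / (M * a.B ^ 2)) ≤ 2 * (a.lamMax - a.lamMin) ^ 2 := by
      rw [← mul_div_assoc, div_le_iff₀ (by positivity)] at hp ⊢
      linarith
    have h2 : μ / (32 * Cρ * (M * a.B ^ 2)) ≤ μ / (M * a.B ^ 2) / 32 := by
      rw [div_div, show 32 * Cρ * (M * a.B ^ 2) = Cρ * (M * a.B ^ 2 * 32) by ring]
      exact div_le_div_of_nonneg_left hμ0.le (by positivity)
        (le_mul_of_one_le_left (by positivity) hC)
    have h3 : J.card * τ ^ 2 ≤ p * (μ / (M * a.B ^ 2) / 32) := by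
      rw [hτ2]
      exact mul_le_mul hJp h2 (by positivity) (Nat.cast_nonneg _)
    linarith
  · have hc := hup j hj
    have hc0 : (0 : ℝ) ≤ D.count {h, j} := Nat.cast_nonneg _
    generalize (D.count {h, j} : ℝ) = c at *
    have h1 : c + N ≤ Cρ * (M * a.B ^ 2) := by
      have : (N : ℝ) ≤ Cρ * N := le_mul_of_one_le_left (Nat.cast_nonneg _) hC
      have := mul_le_mul_of_nonneg_left hM1 hC0.le
      linarith
    have h2 : c ≤ Cρ * (M * a.R ^ 2) := hc.trans (mul_le_mul_of_nonneg_left hM2 hC0.le)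
    have h3 : (c + N) * (4 * τ ^ 2 / l ^ 2) ≤ 1 / 2 := by
      refine (mul_le_mul_of_nonneg_right h1 (by positivity)).trans ?_
      have e : Cρ * (M * a.B ^ 2) * (4 * τ ^ 2 / l ^ 2) = μ / (8 * l ^ 2) := by
        rw [hτ2]
        field_simp
        norm_num
      rw [e, div_le_iff₀ (by positivity)]
      nlinarith
    have h4 : c * (a.B ^ 2 * τ ^ 2 / (2 * l * a.R ^ 2)) ≤ 1 / 2 := by
      refine (mul_le_mul_of_nonneg_right h2 (by positivity)).trans ?_
      have e : Cρ * (M * a.R ^ 2) * (a.B ^ 2 * τ ^ 2 / (2 * l * a.R ^ 2)) = μ / (64 * l) := by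
        rw [hτ2]
        field_simp
        norm_num
      rw [e, div_le_iff₀ (by positivity)]
      linarith
    linarith

end Balanced

end MissingRegression

/-! ### Combination of the two lower bounds -/

theorem mainTheorem5 :
    ∃ c : ℝ, 0 < c ∧
      ∀ (a : MissingRegression.ClassParams),
        0 < a.R → 0 < a.B → 0 < a.χ → a.χ ≤ 1 → 1 ≤ a.C →
        0 < a.lamMin → a.lamMin < a.lamMax →
        Real.sqrt (8 * a.lamMax / 3) ≤ a.CX →
        (105 : ℝ) ^ (1 / 4 : ℝ) ≤ a.κ →
      ∀ (p K L N : ℕ) (D : MissingRegression.Pattern p K) (ξ : Fin p → Fin L),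
        2 ≤ p → 2 ≤ L → D.IsModalityMap ξ →
      ∀ (ρ Cρ : ℝ), 0 < ρ → ρ < 1 → 0 < Cρ → D.IsBalanced ξ ρ Cρ →
        (p : ℝ) * max (1 / 2) (a.R ^ 2 / (4 * a.B ^ 2 * a.lamMin)) ≤ ρ * D.nLab →
        (p : ℝ) * (min 1 (a.lamMax ^ 2) / (2 * a.B ^ 2 * (a.lamMax - a.lamMin) ^ 2)) ≤
          max ((N + ρ ^ 2 * D.nLab) / a.B ^ 2) (ρ ^ 2 * D.nLab / a.R ^ 2) →
        ENNReal.ofReal (c *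
          (1 / (Cρ * a.lamMin) * (a.R ^ 2 * p / (ρ * D.nLab)) +
            min (a.lamMax ^ 2)⁻¹ 1 / Cρ *
              min (a.B ^ 2 * p / (N + ρ ^ 2 * D.nLab)) (a.R ^ 2 * p / (ρ ^ 2 * D.nLab))))
          ≤ D.minimaxRisk N a := by
  -- Half of the smaller constant exp(-2)/256, since the larger of the two terms is at least half of
  -- their sum.
  refine ⟨Real.exp (-2) / 512, by positivity, ?_⟩
  intro a hR hB hχ hχ1 hC hlm hlt hCX hκ p K L N D ξ hp hL hξ ρ Cρ hρ _ hCρ hD h1 h2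
  have ha : a.Admissible := ⟨hR, hB, hχ, hχ1, hC, hlm, hlt, hCX, hκ⟩
  have hp0 : (2 : ℝ) ≤ p := by exact_mod_cast hp
  have hn : 0 < ρ * D.nLab := by
    refine lt_of_lt_of_le ?_ h1
    have := le_max_left (1 / 2 : ℝ) (a.R ^ 2 / (4 * a.B ^ 2 * a.lamMin))
    exact mul_pos (by linarith) (by linarith)
  have hn2 : 0 < ρ ^ 2 * D.nLab := by
    rw [sq, mul_assoc]
    exact mul_pos hρ hn
  -- The two-sided balance condition on a single modality already forces this.
  have hC1 : 1 ≤ Cρ := by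
    have h3 := (hD.h_lower ⟨0, by omega⟩).trans (hD.h_upper ⟨0, by omega⟩)
    rw [mul_assoc] at h3
    exact (le_mul_iff_one_le_left hn).1 h3
  have hA := MissingRegression.coefficient_lower_bound (N := N) ha hξ.toIsBlockPartition hD hn hC1
    ((mul_le_mul_of_nonneg_left (le_max_right _ _) (by positivity)).trans h1)
  have hV := MissingRegression.covariance_lower_bound ha hL hξ.toIsBlockPartition hD hn2 hC1 h2
  have hlM : 0 < a.lamMax := hlm.trans hlt
  have hx : 0 ≤ 1 / (Cρ * a.lamMin) * (a.R ^ 2 * p / (ρ * D.nLab)) := by positivity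
  have hy : 0 ≤ min (a.lamMax ^ 2)⁻¹ 1 / Cρ *
      min (a.B ^ 2 * p / (N + ρ ^ 2 * D.nLab)) (a.R ^ 2 * p / (ρ ^ 2 * D.nLab)) := by
    have := add_pos_of_nonneg_of_pos (Nat.cast_nonneg (α := ℝ) N) hn2
    positivity
  have he := Real.exp_pos (-2)
  generalize 1 / (Cρ * a.lamMin) * (a.R ^ 2 * p / (ρ * D.nLab)) = x at *
  generalize min (a.lamMax ^ 2)⁻¹ 1 / Cρ *
      min (a.B ^ 2 * p / (N + ρ ^ 2 * D.nLab)) (a.R ^ 2 * p / (ρ ^ 2 * D.nLab)) = y at *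
  rcases le_total x y with hxy | hxy
  · exact (ENNReal.ofReal_le_ofReal (by nlinarith)).trans hV
  · exact (ENNReal.ofReal_le_ofReal (by nlinarith)).trans hA
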